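/- All graphs are finite, simple and non-empty, and the length of a path is its number of edges. A $4$-sequence of a graph $H$ is a sequence of partitions of $V(H)$ that starts with the partition into singletons, ends with the partition $\{V(H)\}$, in which every partition is obtained from the previous one by merging two parts into one, and such that, in each of the partitions, every part $P$ has at most $4$ other parts $Q$ for which there are in $H$ both an edge and a non-edge between $P$ and $Q$. Theorem. Let $r : \mathbb N \to \mathbb R$ be a function with $r(N) \to \infty$ as $N \to \infty$. Suppose that at least one of the following two holds. (a) There is a polynomial-time algorithm which, given an $N$-vertex graph $H$ together with a $4$-sequence of $H$ (so $H$ has twin-width at most $4$), outputs a path $P$ of $H$ such that every path of $H$ has length at most $r(N)\cdot|P|$, where $|P|$ is the length of $P$ (that is, an $r$-approximation for Longest Path on graphs given with a $4$-sequence). (b) The same with "induced path" in place of "path" throughout (that is, an $r$-approximation for Longest Induced Path on graphs given with a $4$-sequence). Then there are a function $\delta : \mathbb N \to \mathbb R$ with $\delta(n) \to 0$ as $n \to \infty$ and a polynomial-time algorithm which, given an arbitrary graph $G$ with $n$ vertices and $m$ edges, outputs a path $P$ of $G$ such that every path of $G$ has length at most $(1+\delta(n))\, r(N)\cdot |P|$,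 where $N = n + 2\lceil \log_2 n\rceil\, m$ (that is, a $(1+o(1))\,r$-approximation for Longest Path in general graphs, where the ratio $r$ is taken at the number $N$ of vertices of the graph obtained from $G$ by subdividing each edge $2\lceil\log_2 n\rceil$ times). -/

import Mathlib

open Filter Topology

/-! ### Model of computation

Data are binary trees.  Programs are the `while` programs over binary trees with a single variable
(constant, selection, pairing, sequencing, conditional, loop).  Every elementary operation costs one
step, and building a pair additionally costs the size of the tree that is written, so that the size
of every intermediate tree is at most the size of the input plus the number of steps made so far.
Polynomial time in this model is the usual polynomial time. -/

/-- Binary trees. -/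
inductive Data : Type
  | nil : Data
  | cons : Data → Data → Data

namespace Data

/-- Number of nodes of a tree. -/
def size : Data → ℕ
  | nil => 1
  | cons a b => a.size + b.size + 1

/-- Left subtree (`nil` has left subtree `nil`). -/
def head : Data → Data
  | nil => nil
  | cons a _ => a

/-- Right subtree (`nil` has right subtree `nil`). -/
def tail : Data → Data
  | nil => nil
  | cons _ b => b

/-- Encoding of lists: right combs. -/
def ofList : List Data → Data
  | [] => nil
  | a :: l => cons a (ofList l)

/-- Encoding of natural numbers, in unary.  Only names of vertices of the input graph, which are
smaller than the number of its vertices, are encoded in this way. -/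
def ofNat : ℕ → Data
  | 0 => nil
  | k + 1 => cons nil (ofNat k)

open Classical in
/-- Encoding of truth values: `nil` is false. -/
noncomputable def ofProp (a : Prop) : Data :=
  if a then cons nil nil else nil

/-- Encoding of a binary relation on `{0, …, n - 1}` by its 0/1-matrix, row by row. -/
noncomputable def ofRel {n : ℕ} (R : Fin n → Fin n → Prop) : Data :=
  ofList ((List.finRange n).map fun i =>
    ofList ((List.finRange n).map fun j => ofProp (R i j)))

end Data

/-- Programs; each one maps the current tree to a new tree. -/
inductive Prog : Type
  | nil : Prog
  | id : Prog
  | head : Prog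
  | tail : Prog
  | cons : Prog → Prog → Prog
  | seq : Prog → Prog → Prog
  | cond : Prog → Prog → Prog → Prog
  | loop : Prog → Prog → Prog

/-- `Prog.Runs p x y t`: on input `x` the program `p` halts with output `y` after exactly
`t` steps. -/
inductive Prog.Runs : Prog → Data → Data → ℕ → Prop
  | nil (x : Data) : Prog.Runs .nil x .nil 1
  | id (x : Data) : Prog.Runs .id x x 1
  | head (x : Data) : Prog.Runs .head x x.head 1
  | tail (x : Data) : Prog.Runs .tail x x.tail 1
  -- `cons f g` maps `x` to the tree with subtrees `f x` and `g x`
  | cons {f g : Prog} {x a b : Data} {t₁ t₂ : ℕ} :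
      Prog.Runs f x a t₁ → Prog.Runs g x b t₂ →
      Prog.Runs (.cons f g) x (.cons a b) (t₁ + t₂ + (Data.cons a b).size)
  -- `seq f g` runs first `f`, then `g`
  | seq {f g : Prog} {x y z : Data} {t₁ t₂ : ℕ} :
      Prog.Runs f x y t₁ → Prog.Runs g y z t₂ →
      Prog.Runs (.seq f g) x z (t₁ + t₂ + 1)
  -- `cond c f g` runs `f` if the value of the test `c` is not `nil`, and `g` otherwise
  | cond_true {c f g : Prog} {x a b y : Data} {t₁ t₂ : ℕ} :
      Prog.Runs c x (.cons a b) t₁ → Prog.Runs f x y t₂ →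
      Prog.Runs (.cond c f g) x y (t₁ + t₂ + 1)
  | cond_false {c f g : Prog} {x y : Data} {t₁ t₂ : ℕ} :
      Prog.Runs c x .nil t₁ → Prog.Runs g x y t₂ →
      Prog.Runs (.cond c f g) x y (t₁ + t₂ + 1)
  -- `loop c f` repeats `f` as long as the value of the test `c` is not `nil`
  | loop_stop {c f : Prog} {x : Data} {t : ℕ} :
      Prog.Runs c x .nil t → Prog.Runs (.loop c f) x x (t + 1)
  | loop_step {c f : Prog} {x a b y z : Data} {t₁ t₂ t₃ : ℕ} :
      Prog.Runs c x (.cons a b) t₁ → Prog.Runs f x y t₂ → Prog.Runs (.loop c f) y z t₃ →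
      Prog.Runs (.loop c f) x z (t₁ + t₂ + t₃ + 1)

/-- On input `x` the program `p` halts within `P (size of x)` steps, and its output is one of the
accepted outputs `Good`. -/
def Prog.SolvesWithin (p : Prog) (P : Polynomial ℕ) (x : Data) (Good : Data → Prop) : Prop :=
  ∃ (y : Data) (t : ℕ), p.Runs x y t ∧ t ≤ P.eval x.size ∧ Good y

/-! ### Partition sequences

A partition of the vertex set is an equivalence relation; its parts are the elements of the
quotient. -/

/-- The partition `t` is obtained from the partition `s` by merging two distinct parts (those of
`u` and of `v`) into one. -/
def MergesTo {V : Type*} (s t : Setoid V) : Prop :=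
  ∃ u v : V, ¬ s.r u v ∧
    ∀ x y : V, t.r x y ↔ s.r x y ∨ (s.r x u ∧ s.r y v) ∨ (s.r x v ∧ s.r y u)

/-- Red degree of the part `P` of the partition `s`: the number of other parts `Q` such that there
are in `G` both an edge and a non-edge between `P` and `Q`. -/
noncomputable def redDegree {V : Type*} (G : SimpleGraph V) (s : Setoid V) (P : Quotient s) : ℕ :=
  Set.ncard {Q : Quotient s | Q ≠ P ∧
    (∃ x y : V, Quotient.mk s x = P ∧ Quotient.mk s y = Q ∧ G.Adj x y) ∧
    (∃ x y : V, Quotient.mk s x = P ∧ Quotient.mk s y = Q ∧ ¬ G.Adj x y)}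

/-- `S` is a (partition) `d`-sequence of `G`: it starts with the partition into singletons, ends
with the partition with a single part, each partition arises from the previous one by merging two
parts, and no part of any of the partitions has red degree more than `d`. -/
def IsTwinSequence {V : Type*} (G : SimpleGraph V) (d : ℕ) (S : List (Setoid V)) : Prop :=
  S.head? = some ⊥ ∧ S.getLast? = some ⊤ ∧ S.IsChain MergesTo ∧
    ∀ s ∈ S, ∀ P : Quotient s, redDegree G s P ≤ d

/-! ### Encodings -/

/-- A graph is encoded by its adjacency matrix. -/
noncomputable def encodeGraph {n : ℕ} (G : SimpleGraph (Fin n)) : Data :=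
  Data.ofRel G.Adj

/-- A graph together with a sequence of partitions, each of them encoded by the 0/1-matrix of
"being in the same part". -/
noncomputable def encodeGraphSeq {n : ℕ} (G : SimpleGraph (Fin n)) (S : List (Setoid (Fin n))) :
    Data :=
  Data.cons (encodeGraph G) (Data.ofList (S.map fun s => Data.ofRel s.r))

/-- A path is encoded by the list of its vertices. -/
def encodeVertices {n : ℕ} (l : List (Fin n)) : Data :=
  Data.ofList (l.map fun i => Data.ofNat i)

/-! ### The two problems and their approximation -/

/-- An induced path: a path such that all edges of `G` between its vertices belong to it. -/
def IsInducedPath {V : Type*} {G : SimpleGraph V} {u v : V} (p : G.Walk u v) : Prop :=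
  p.IsPath ∧ p.toSubgraph.IsInduced

/-- `y` encodes a path of `G` (of length, that is number of edges, `ℓ`) such that every path of `G`
has length at most `ρ * ℓ`. -/
def ApproxLongestPath {n : ℕ} (G : SimpleGraph (Fin n)) (ρ : ℝ) (y : Data) : Prop :=
  ∃ (u v : Fin n) (p : G.Walk u v), p.IsPath ∧ y = encodeVertices p.support ∧
    ∀ (u' v' : Fin n) (q : G.Walk u' v'), q.IsPath → (q.length : ℝ) ≤ ρ * (p.length : ℝ)

/-- `y` encodes an induced path of `G` (of length `ℓ`) such that every induced path of `G` has
length at most `ρ * ℓ`. -/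
def ApproxLongestInducedPath {n : ℕ} (G : SimpleGraph (Fin n)) (ρ : ℝ) (y : Data) : Prop :=
  ∃ (u v : Fin n) (p : G.Walk u v), IsInducedPath p ∧ y = encodeVertices p.support ∧
    ∀ (u' v' : Fin n) (q : G.Walk u' v'), IsInducedPath q → (q.length : ℝ) ≤ ρ * (p.length : ℝ)

/-- Longest Path on graphs given with a `d`-sequence has a polynomial-time `r`-approximation, where
`r` is a function of the number of vertices of the input graph. -/
def LongestPathApproxGivenSequence (d : ℕ) (r : ℕ → ℝ) : Prop :=
  ∃ (A : Prog) (P : Polynomial ℕ), ∀ (n : ℕ) (G : SimpleGraph (Fin n)) (S : List (Setoid (Fin n))),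
    0 < n → IsTwinSequence G d S →
      A.SolvesWithin P (encodeGraphSeq G S) (ApproxLongestPath G (r n))

/-- Longest Induced Path on graphs given with a `d`-sequence has a polynomial-time
`r`-approximation, where `r` is a function of the number of vertices of the input graph. -/
def LongestInducedPathApproxGivenSequence (d : ℕ) (r : ℕ → ℝ) : Prop :=
  ∃ (A : Prog) (P : Polynomial ℕ), ∀ (n : ℕ) (G : SimpleGraph (Fin n)) (S : List (Setoid (Fin n))),
    0 < n → IsTwinSequence G d S →
      A.SolvesWithin P (encodeGraphSeq G S) (ApproxLongestInducedPath G (r n))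

/-- Longest Path on general graphs has a polynomial-time approximation algorithm whose ratio on the
graph `G` is `ρ G`. -/
def LongestPathApprox (ρ : ∀ n : ℕ, SimpleGraph (Fin n) → ℝ) : Prop :=
  ∃ (A : Prog) (P : Polynomial ℕ), ∀ (n : ℕ) (G : SimpleGraph (Fin n)),
    0 < n → A.SolvesWithin P (encodeGraph G) (ApproxLongestPath G (ρ n G))

/-- The number of vertices of the graph obtained from the `n`-vertex graph `G` by subdividing each
of its edges `2 ⌈log₂ n⌉` times. -/
noncomputable def subdividedOrder {n : ℕ} (G : SimpleGraph (Fin n)) : ℕ :=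
  n + 2 * Nat.clog 2 n * G.edgeSet.ncard

/-!
Subdivide every edge of the graph `G` on `n` vertices `2 L` times, `L = ⌈log₂ n⌉`.  Paths of `G` with
`ℓ` edges become induced paths of the subdivision `H` with `(2 L + 1) ℓ` edges, and a path of `H` with
`b` original vertices has at most `(2 L + 1) (b + 1)` vertices, while its original vertices form a path
of `G`.  So an approximation of the longest path, or of the longest induced path, of `H` approximates
the longest path of `G` with the same ratio, up to a loss of two edges at the ends
(`EdgeListed.infix_expand_of_link`, `EdgeListed.branches_of_path`).

*The `4`-sequence.*  Take the original vertices as leaves of a binary tree of height `L`.  The `k`-th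
vertex, `k ≤ L`, on a subdivided edge from `u` to `v` is merged into the ancestor of `u` of level `k`,
edge by edge and along each edge from one end to the other.  A tree node is then joined by red edges
at most to its parent, to its two children and to the vertex that is merged next; original vertices
and vertices that are not merged yet are alone in their parts.  When `H` has been folded onto the
tree, the tree is contracted level by level (`EdgeListed.red_neighbors`,
`EdgeListed.isTwinSequence_subdivision`).  A partition is represented by a labelling of the vertices
of `H`, and a merge by the replacement of a label; replacements that do not change the partition are
skipped.

*The loss at the ends.*  A loss of two edges does not matter for long paths.  To deal with the short
ones, a depth-first search is made: if its stacks have at most `D` elements, then all paths of `G` have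
fewer than `2 ^ D` vertices (`length_lt_of_dfsStacks`).  Hence, if neither the approximation for `H` nor
the search finds a path with at least `K` edges, all paths of `G` have at most `2 ^ K` edges, which is
at most `r N` if `K = K n` tends to infinity slowly enough; this is where `r N → ∞` is used
(`exists_slow_function`, `longestPathApprox_of_subdivision`).

*Polynomial time.*  The algorithms are functions on lists and numbers, and `PolyTime` says that such a
function is computed on encodings by a program in polynomial time.  This property is closed under
composition, pairing, case distinction and folds over lists with results of polynomial size
(`PolyTime.foldl`), from which all functions needed are built.
-/

/-! ### Polynomial-time functions between encoded types -/

/-- Types whose elements are encoded as trees. -/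
class Enc (α : Type) where
  enc : α → Data

open Enc (enc)

namespace Enc

instance : Enc Unit := ⟨fun _ => Data.nil⟩
instance : Enc Bool := ⟨fun b => bif b then Data.cons Data.nil Data.nil else Data.nil⟩
instance : Enc ℕ := ⟨Data.ofNat⟩
instance {α β : Type} [Enc α] [Enc β] : Enc (α × β) := ⟨fun x => Data.cons (enc x.1) (enc x.2)⟩
instance {α : Type} [Enc α] : Enc (List α) := ⟨fun l => Data.ofList (l.map enc)⟩

/-- The size of the encoding. -/
def esize {α : Type} [Enc α] (a : α) : ℕ := (enc a).size

variable {α β : Type} [Enc α] [Enc β]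

theorem enc_pair (a : α) (b : β) : enc (a, b) = Data.cons (enc a) (enc b) := rfl
theorem enc_cons (a : α) (l : List α) : enc (a :: l) = Data.cons (enc a) (enc l) := rfl
theorem enc_map {ι : Type} (f : ι → α) (l : List ι) :
    enc (l.map f) = Data.ofList (l.map fun i => enc (f i)) := by
  change Data.ofList _ = _
  rw [List.map_map]; rfl

theorem enc_true : enc true = Data.cons Data.nil Data.nil := rfl
theorem enc_false : enc false = Data.nil := rfl
theorem enc_succ (n : ℕ) : enc (n + 1) = Data.cons Data.nil (enc n) := rfl

theorem enc_replicate (n : ℕ) : enc (List.replicate n ()) = enc n := by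
  induction n with
  | zero => rfl
  | succ n ih => rw [List.replicate_succ, enc_cons, enc_succ, ih]; rfl

theorem esize_def (a : α) : esize a = (enc a).size := rfl
theorem one_le_size (x : Data) : 1 ≤ x.size := by cases x <;> simp [Data.size]
theorem one_le_esize (a : α) : 1 ≤ esize a := one_le_size _
@[simp] theorem esize_pair (a : α) (b : β) : esize (a, b) = esize a + esize b + 1 := rfl
@[simp] theorem esize_nil : esize ([] : List α) = 1 := rfl
@[simp] theorem esize_cons (a : α) (l : List α) : esize (a :: l) = esize a + esize l + 1 := rfl

@[simp] theorem esize_nat (n : ℕ) : esize n = 2 * n + 1 := by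
  induction n with
  | zero => rfl
  | succ n ih =>
    rw [esize_def, enc_succ, Data.size, ← esize_def, ih]; simp only [Data.size]; ring

theorem esize_append (l l' : List α) : esize (l ++ l') + 1 = esize l + esize l' := by
  induction l with
  | nil => simp [add_comm]
  | cons a l ih => simp only [List.cons_append, esize_cons]; omega

theorem esize_mem_lt {a : α} {l : List α} (h : a ∈ l) : esize a < esize l := by
  induction l with
  | nil => simp at h
  | cons b l ih =>
    rw [esize_cons]
    rcases List.mem_cons.1 h with rfl | h
    · omega
    · have := ih h; omega

theorem length_lt_esize (l : List α) : l.length < esize l := by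
  induction l with
  | nil => simp
  | cons b l ih => simp only [esize_cons, List.length_cons]; omega

theorem esize_le_of_prefix {l l' : List α} (h : l' <+: l) : esize l' ≤ esize l := by
  obtain ⟨t, rfl⟩ := h
  have := esize_append l' t
  have := one_le_esize t
  omega

theorem esize_le_of_forall_mem {l : List α} {K : ℕ} (h : ∀ a ∈ l, esize a ≤ K) :
    esize l ≤ l.length * (K + 1) + 1 := by
  induction l with
  | nil => simp
  | cons a l ih =>
    have h1 := h a (by simp)
    have h2 := ih fun b hb => h b (by simp [hb])
    simp only [esize_cons, List.length_cons, add_mul]; omega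

end Enc

open Enc

theorem Prog.Runs.size_le {p : Prog} {x y : Data} {t : ℕ} (h : p.Runs x y t) :
    y.size ≤ x.size + t := by
  induction h with
  | nil x => simp [Data.size]
  | id x => omega
  | head x => cases x <;> simp only [Data.head, Data.size] <;> omega
  | tail x => cases x <;> simp only [Data.tail, Data.size] <;> omega
  | cons _ _ _ _ => omega
  | seq _ _ _ _ => omega
  | cond_true _ _ _ _ => omega
  | cond_false _ _ _ _ => omega
  | loop_stop _ _ => omega
  | loop_step _ _ _ _ _ _ => omega

theorem Polynomial.eval_mono_nat (P : Polynomial ℕ) {a b : ℕ} (h : a ≤ b) :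
    P.eval a ≤ P.eval b := by
  simp only [Polynomial.eval_eq_sum, Polynomial.sum]
  gcongr

/-- `f` is computed by a program in polynomial time. -/
def PolyTime {α β : Type} [Enc α] [Enc β] (f : α → β) : Prop :=
  ∃ (p : Prog) (P : Polynomial ℕ), ∀ a, ∃ t, p.Runs (enc a) (enc (f a)) t ∧ t ≤ P.eval (esize a)

namespace PolyTime

variable {α β γ δ : Type} [Enc α] [Enc β] [Enc γ] [Enc δ]

theorem exists_esize_le {f : α → β} (hf : PolyTime f) :
    ∃ P : Polynomial ℕ, ∀ a, esize (f a) ≤ P.eval (esize a) := by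
  obtain ⟨p, P, h⟩ := hf
  refine ⟨Polynomial.X + P, fun a => ?_⟩
  obtain ⟨t, ht, hP⟩ := h a
  have := ht.size_le
  simp only [Polynomial.eval_add, Polynomial.eval_X, esize_def] at *
  omega

/-- Functions that are the identity on the level of encodings. -/
theorem of_enc_eq {f : α → β} (h : ∀ a, enc (f a) = enc a) : PolyTime f :=
  ⟨.id, 1, fun a => ⟨1, by rw [h]; exact .id _, by simp⟩⟩

theorem id : PolyTime fun a : α => a := of_enc_eq fun _ => rfl

theorem fst : PolyTime (Prod.fst : α × β → α) := ⟨.head, 1, fun a => ⟨1, .head (enc a), by simp⟩⟩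

theorem snd : PolyTime (Prod.snd : α × β → β) := ⟨.tail, 1, fun a => ⟨1, .tail (enc a), by simp⟩⟩

theorem comp {g : β → γ} {f : α → β} (hg : PolyTime g) (hf : PolyTime f) :
    PolyTime fun a => g (f a) := by
  obtain ⟨p, P, hp⟩ := hf
  obtain ⟨q, Q, hq⟩ := hg
  refine ⟨.seq p q, P + Q.comp (Polynomial.X + P) + 1, fun a => ?_⟩
  obtain ⟨t, ht, hP⟩ := hp a
  obtain ⟨s, hs, hQ⟩ := hq (f a)
  refine ⟨_, .seq ht hs, ?_⟩
  have h1 : esize (f a) ≤ esize a + P.eval (esize a) := ht.size_le.trans (by simpa [esize_def])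
  have h2 := Q.eval_mono_nat h1
  simp only [Polynomial.eval_add, Polynomial.eval_X, Polynomial.eval_comp, Polynomial.eval_one]
  omega

theorem pair {g : α → γ} {f : α → β} (hf : PolyTime f) (hg : PolyTime g) :
    PolyTime fun a => (f a, g a) := by
  obtain ⟨p, P, hp⟩ := hf
  obtain ⟨q, Q, hq⟩ := hg
  refine ⟨.cons p q, 2 * P + 2 * Q + 2 * Polynomial.X + 1, fun a => ?_⟩
  obtain ⟨t, ht, hP⟩ := hp a
  obtain ⟨s, hs, hQ⟩ := hq a
  refine ⟨_, .cons ht hs, ?_⟩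
  have h1 := ht.size_le
  have h2 := hs.size_le
  simp only [Polynomial.eval_add, Polynomial.eval_X, Polynomial.eval_mul, Polynomial.eval_one,
    Polynomial.eval_ofNat, Data.size, esize_def] at *
  omega

theorem const (b : β) : PolyTime fun _ : α => b := by
  suffices h : ∀ d : Data, ∃ (p : Prog) (T : ℕ), ∀ x, p.Runs x d T by
    obtain ⟨p, T, h⟩ := h (enc b)
    exact ⟨p, Polynomial.C T, fun a => ⟨T, h _, by simp⟩⟩
  intro d
  induction d with
  | nil => exact ⟨.nil, 1, .nil⟩
  | cons d e hd he =>
    obtain ⟨p, T, hp⟩ := hd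
    obtain ⟨q, S, hq⟩ := he
    exact ⟨.cons p q, _, fun x => .cons (hp x) (hq x)⟩

theorem ite {p : α → Prop} [DecidablePred p] {f g : α → β} (hp : PolyTime fun a => decide (p a))
    (hf : PolyTime f) (hg : PolyTime g) : PolyTime fun a => if p a then f a else g a := by
  obtain ⟨c, R, hc⟩ := hp
  obtain ⟨p', P, hp⟩ := hf
  obtain ⟨q, Q, hq⟩ := hg
  refine ⟨.cond c p' q, R + P + Q + 1, fun a => ?_⟩
  obtain ⟨t, ht, hP⟩ := hp a
  obtain ⟨s, hs, hQ⟩ := hq a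
  obtain ⟨u, hu, hR⟩ := hc a
  simp only [Polynomial.eval_add, Polynomial.eval_one]
  by_cases h : p a
  · simp only [h, decide_true, if_true, enc_true] at *
    exact ⟨_, .cond_true hu ht, by omega⟩
  · simp only [h, decide_false, if_false, enc_false] at *
    exact ⟨_, .cond_false hu hs, by omega⟩

theorem cons {f : α → β} {g : α → List β} (hf : PolyTime f) (hg : PolyTime g) :
    PolyTime fun a => f a :: g a :=
  (of_enc_eq (f := fun x : β × List β => x.1 :: x.2) fun _ => rfl).comp (hf.pair hg)

theorem isEmpty {f : α → List β} (hf : PolyTime f) : PolyTime fun a => (f a).isEmpty := by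
  refine comp (g := List.isEmpty) ⟨.cond .id .nil (.cons .nil .nil), 10, fun l => ?_⟩ hf
  cases l with
  | nil => exact ⟨_, .cond_false (.id _) (.cons (.nil _) (.nil _)), by simp [Data.size]⟩
  | cons a l => exact ⟨_, .cond_true (.id _) (.nil _), by simp⟩

theorem listTail {f : α → List β} (hf : PolyTime f) : PolyTime fun a => (f a).tail := by
  refine comp (g := List.tail) ⟨.tail, 1, fun l => ⟨1, ?_, by simp⟩⟩ hf
  cases l <;> exact .tail _

theorem headD {f : α → List β} (hf : PolyTime f) (d : β) : PolyTime fun a => (f a).headD d := by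
  obtain ⟨p, P, hp⟩ := const (α := List β) d
  refine comp (g := fun l : List β => l.headD d) ⟨.cond .id .head p, P + 3, fun l => ?_⟩ hf
  obtain ⟨t, ht, hP⟩ := hp l
  simp only [Polynomial.eval_add, Polynomial.eval_ofNat]
  cases l with
  | nil => exact ⟨_, .cond_false (.id _) ht, by omega⟩
  | cons a l => exact ⟨_, .cond_true (.id _) (.head _), by omega⟩

theorem add_one {f : α → ℕ} (hf : PolyTime f) : PolyTime fun a => f a + 1 :=
  (of_enc_eq (f := fun x : Unit × ℕ => x.2 + 1) fun _ => rfl).comp ((const ()).pair hf)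

theorem pred {f : α → ℕ} (hf : PolyTime f) : PolyTime fun a => f a - 1 := by
  refine comp (g := fun n => n - 1) ⟨.tail, 1, fun n => ⟨1, ?_, by simp⟩⟩ hf
  cases n <;> exact .tail _

theorem replicate {f : α → ℕ} (hf : PolyTime f) : PolyTime fun a => List.replicate (f a) () :=
  (of_enc_eq enc_replicate).comp hf

/-- The time of a loop that consumes a list, from a bound on the time of each of its rounds. -/
theorem runs_loop {c : γ} {step : β → α → β} {body : Prog} {B K : ℕ}
    (hbody : ∀ acc a l, esize (c, acc, a :: l) ≤ K →
      ∃ t, body.Runs (enc (c, acc, a :: l)) (enc (c, step acc a, l)) t ∧ t ≤ B)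
    (l : List α) (acc : β)
    (hK : ∀ l₁ l₂, l₁ ++ l₂ = l → esize (c, l₁.foldl step acc, l₂) ≤ K) :
    ∃ t, (Prog.loop (.seq .tail .tail) body).Runs (enc (c, acc, l))
      (enc (c, l.foldl step acc, ([] : List α))) t ∧ t ≤ (l.length + 1) * (B + 4) := by
  induction l generalizing acc with
  | nil => exact ⟨_, Prog.Runs.loop_stop (.seq (.tail _) (.tail _)), by simp⟩
  | cons a l ih =>
    obtain ⟨t, ht, htB⟩ := hbody acc a l (hK [] _ rfl)
    obtain ⟨s, hs, hsB⟩ := ih (step acc a) fun l₁ l₂ h => hK (a :: l₁) l₂ (by simp [h])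
    refine ⟨_, .loop_step (.seq (.tail _) (.tail _)) ht hs, ?_⟩
    simp only [List.length_cons]
    rw [add_mul (l.length + 1) 1]
    omega

/-- A fold is computed in polynomial time if its step is and if the intermediate results have
polynomial size. -/
theorem foldl {l : γ → List α} {init : γ → β} {step : γ → β → α → β} (hl : PolyTime l)
    (hi : PolyTime init) (hs : PolyTime fun x : γ × β × α => step x.1 x.2.1 x.2.2)
    (Q : Polynomial ℕ)
    (hQ : ∀ c l', l' <+: l c → esize (l'.foldl (step c) (init c)) ≤ Q.eval (esize c)) :
    PolyTime fun c => (l c).foldl (step c) (init c) := by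
  obtain ⟨R, hR⟩ := hl.exists_esize_le
  obtain ⟨pre, P₁, hpre⟩ := id.pair (hi.pair hl)
  obtain ⟨ps, P₂, hps⟩ := hs
  let X : Polynomial ℕ := Polynomial.X
  -- `K` bounds the size of all states, `B` the time of one round
  let K : Polynomial ℕ := X + Q + R + 2
  let B : Polynomial ℕ := 3 * P₂.comp K + 12 * K + 40
  let body : Prog := .cons .head (.cons (.seq (.cons .head (.cons (.seq .tail .head)
    (.seq (.seq .tail .tail) .head))) ps) (.seq (.seq .tail .tail) .tail))
  refine ⟨.seq pre (.seq (.loop (.seq .tail .tail) body) (.seq .tail .head)),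
    P₁ + (R + 1) * (B + 4) + 5, fun c => ?_⟩
  obtain ⟨t₁, h₁, ht₁⟩ := hpre c
  have hbody : ∀ acc a l', esize (c, acc, a :: l') ≤ K.eval (esize c) →
      ∃ t, body.Runs (enc (c, acc, a :: l')) (enc (c, step c acc a, l')) t ∧
        t ≤ B.eval (esize c) := by
    intro acc a l' hK
    obtain ⟨t, ht, htP⟩ := hps (c, acc, a)
    have hr : body.Runs (enc (c, acc, a :: l')) (enc (c, step c acc a, l')) _ :=
      .cons (.head _) (.cons (.seq (.cons (.head _) (.cons (.seq (.tail _) (.head _))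
        (.seq (.seq (.tail _) (.tail _)) (.head _)))) ht)
          (.seq (.seq (.tail _) (.tail _)) (.tail _)))
    refine ⟨_, hr, ?_⟩
    have h3 : esize (c, acc, a) ≤ K.eval (esize c) := by
      simp only [esize_pair, esize_cons] at *; omega
    have h4 := ht.size_le
    have h5 := P₂.eval_mono_nat h3
    change _ ≤ (3 * P₂.comp K + 12 * K + 40).eval (esize c)
    generalize hKe : K.eval (esize c) = k at *
    simp only [Polynomial.eval_add, Polynomial.eval_mul, Polynomial.eval_ofNat,
      Polynomial.eval_comp, hKe]
    change (enc (step c acc a)).size ≤ esize (c, acc, a) + t at h4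
    change t ≤ P₂.eval (esize (c, acc, a)) at htP
    simp only [Data.size, Data.head, Data.tail, enc_pair, enc_cons, esize_def] at *
    omega
  obtain ⟨t₂, h₂, ht₂⟩ := runs_loop hbody (l c) (init c) (by
    rintro l₁ l₂ h
    have h1 := hQ c l₁ ⟨l₂, h⟩
    have h2 := esize_append l₁ l₂
    rw [h] at h2
    have h3 := hR c
    have h4 := one_le_esize l₁
    simp only [K, X, esize_pair, Polynomial.eval_add, Polynomial.eval_X, Polynomial.eval_ofNat]
    omega)
  refine ⟨_, .seq h₁ (.seq h₂ (.seq (.tail _) (.head _))), ?_⟩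
  have h3 := (length_lt_esize (l c)).le.trans (hR c)
  have h4 : ((l c).length + 1) * (B.eval (esize c) + 4) ≤
    (R.eval (esize c) + 1) * (B.eval (esize c) + 4) := by gcongr
  simp only [Polynomial.eval_add, Polynomial.eval_mul, Polynomial.eval_ofNat, Polynomial.eval_one]
  omega

/-- A fold is computed in polynomial time if its step is and if each step increases the size of the
result by a polynomial that does not depend on the result. -/
theorem foldl_of_add_le {l : γ → List α} {init : γ → β} {step : γ → β → α → β} (hl : PolyTime l)
    (hi : PolyTime init) (hs : PolyTime fun x : γ × β × α => step x.1 x.2.1 x.2.2)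
    (R : Polynomial ℕ)
    (hR : ∀ c acc, ∀ a ∈ l c, esize (step c acc a) ≤ esize acc + R.eval (esize c + esize a)) :
    PolyTime fun c => (l c).foldl (step c) (init c) := by
  obtain ⟨L, hL⟩ := hl.exists_esize_le
  obtain ⟨I, hI⟩ := hi.exists_esize_le
  refine foldl hl hi hs (I + L * R.comp (Polynomial.X + L)) fun c l' hl' => ?_
  have key : ∀ (l' : List α) (acc : β), (∀ a ∈ l', a ∈ l c) →
      esize (l'.foldl (step c) acc) ≤
        esize acc + l'.length * R.eval (esize c + L.eval (esize c)) := by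
    intro l'
    induction l' with
    | nil => simp
    | cons a l' ih =>
      intro acc h
      have h1 := ih (step c acc a) fun b hb => h b (by simp [hb])
      have h2 := hR c acc a (h a (by simp))
      have h3 : R.eval (esize c + esize a) ≤ R.eval (esize c + L.eval (esize c)) :=
        R.eval_mono_nat (by have := esize_mem_lt (h a (by simp)); have := hL c; omega)
      simp only [List.foldl_cons, List.length_cons, add_mul]
      omega
  refine (key l' (init c) fun a ha => hl'.subset ha).trans ?_
  have h1 : l'.length ≤ L.eval (esize c) :=
    hl'.length_le.trans ((length_lt_esize _).le.trans (hL c))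
  simp only [Polynomial.eval_add, Polynomial.eval_mul, Polynomial.eval_X, Polynomial.eval_comp]
  gcongr
  exact hI c

end PolyTime

theorem Enc.esize_true : esize true = 3 := rfl
theorem Enc.esize_false : esize false = 1 := rfl

namespace PolyTime

variable {α β γ : Type} [Enc α] [Enc β] [Enc γ]

theorem fst' {f : γ → α × β} (hf : PolyTime f) : PolyTime fun c => (f c).1 := fst.comp hf

theorem snd' {f : γ → α × β} (hf : PolyTime f) : PolyTime fun c => (f c).2 := snd.comp hf

theorem reverse {f : γ → List α} (hf : PolyTime f) : PolyTime fun c => (f c).reverse := by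
  have h : PolyTime fun c => (f c).foldl (fun (acc : List α) a => a :: acc) [] :=
    foldl_of_add_le hf (const []) (cons (snd.comp snd) (fst.comp snd)) (Polynomial.X + 1) (by
      intro c acc a _
      simp only [esize_cons, Polynomial.eval_add, Polynomial.eval_X, Polynomial.eval_one]; omega)
  simpa [List.foldl_flip_cons_eq_append'] using h

theorem append {f g : γ → List α} (hf : PolyTime f) (hg : PolyTime g) :
    PolyTime fun c => f c ++ g c := by
  have h : PolyTime fun c => (f c).reverse.foldl (fun (acc : List α) a => a :: acc) (g c) :=
    foldl_of_add_le hf.reverse hg (cons (snd.comp snd) (fst.comp snd)) (Polynomial.X + 1) (by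
      intro c acc a _
      simp only [esize_cons, Polynomial.eval_add, Polynomial.eval_X, Polynomial.eval_one]; omega)
  simpa [List.foldl_flip_cons_eq_append'] using h

theorem flatMap {l : γ → List α} {f : γ → α → List β} (hl : PolyTime l)
    (hf : PolyTime fun x : γ × α => f x.1 x.2) : PolyTime fun c => (l c).flatMap (f c) := by
  obtain ⟨R, hR⟩ := hf.exists_esize_le
  have h : PolyTime fun c => (l c).foldl (fun acc a => acc ++ f c a) [] :=
    foldl_of_add_le hl (const []) (append (fst.comp snd) (hf.comp (fst.pair (snd.comp snd))))
      (R.comp (Polynomial.X + 1)) (by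
        intro c acc a _
        have h1 := hR (c, a)
        have h2 := esize_append acc (f c a)
        simp only [Polynomial.eval_comp, Polynomial.eval_add, Polynomial.eval_X,
          Polynomial.eval_one, esize_pair] at *
        omega)
  have key : ∀ c (l' : List α) acc,
      l'.foldl (fun acc a => acc ++ f c a) acc = acc ++ l'.flatMap (f c) := by
    intro c l'
    induction l' with
    | nil => simp
    | cons a l' ih => intro acc; simp [ih]
  simpa [key] using h

theorem map {l : γ → List α} {f : γ → α → β} (hl : PolyTime l)
    (hf : PolyTime fun x : γ × α => f x.1 x.2) : PolyTime fun c => (l c).map (f c) := by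
  have h : PolyTime fun c => (l c).flatMap fun a => [f c a] := flatMap hl (cons hf (const []))
  simpa only [List.map_eq_flatMap] using h

theorem not {f : γ → Bool} (hf : PolyTime f) : PolyTime fun c => !f c := by
  have h : PolyTime fun c => if f c = true then false else true :=
    ite (by simpa using hf) (const _) (const _)
  convert h with c
  cases f c <;> rfl

theorem and {f g : γ → Bool} (hf : PolyTime f) (hg : PolyTime g) :
    PolyTime fun c => f c && g c := by
  have h : PolyTime fun c => if f c = true then g c else false :=
    ite (by simpa using hf) hg (const _)
  convert h with c
  cases f c <;> rfl

theorem or {f g : γ → Bool} (hf : PolyTime f) (hg : PolyTime g) :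
    PolyTime fun c => f c || g c := by
  have h : PolyTime fun c => if f c = true then true else g c :=
    ite (by simpa using hf) (const _) hg
  convert h with c
  cases f c <;> rfl

theorem filter {l : γ → List α} {p : γ → α → Bool} (hl : PolyTime l)
    (hp : PolyTime fun x : γ × α => p x.1 x.2) : PolyTime fun c => (l c).filter (p c) := by
  have h : PolyTime fun c => (l c).flatMap fun a => if p c a = true then [a] else [] :=
    flatMap hl (ite (by simpa using hp) (cons snd (const [])) (const []))
  convert h with c
  induction l c with
  | nil => rfl
  | cons a l ih => by_cases h : p c a = true <;> simp [h, ih]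

theorem any {l : γ → List α} {p : γ → α → Bool} (hl : PolyTime l)
    (hp : PolyTime fun x : γ × α => p x.1 x.2) : PolyTime fun c => (l c).any (p c) := by
  have h : PolyTime fun c => !((l c).filter (p c)).isEmpty := (filter hl hp).isEmpty.not
  convert h with c
  rw [Bool.eq_iff_iff]
  simp [List.filter_eq_nil_iff]

theorem length {l : γ → List α} (hl : PolyTime l) : PolyTime fun c => (l c).length := by
  have h : PolyTime fun c => (l c).foldl (fun (n : ℕ) _ => n + 1) 0 :=
    foldl_of_add_le hl (const 0) (add_one (fst.comp snd)) 2 (by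
      intro c n a _
      simp only [esize_nat, Polynomial.eval_ofNat]; omega)
  simpa using h

/-- Iteration, with a bound on the size of the intermediate results. -/
theorem iterate {k : γ → ℕ} {init : γ → β} {f : γ → β → β} (hk : PolyTime k) (hi : PolyTime init)
    (hf : PolyTime fun x : γ × β => f x.1 x.2) (R : Polynomial ℕ)
    (hR : ∀ c b, esize (f c b) ≤ esize b + R.eval (esize c)) :
    PolyTime fun c => (f c)^[k c] (init c) := by
  have h : PolyTime fun c => (List.replicate (k c) ()).foldl (fun b _ => f c b) (init c) :=
    foldl_of_add_le hk.replicate hi (hf.comp (fst.pair (fst.comp snd))) R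
      fun c b _ _ => (hR c b).trans (by gcongr; exact R.eval_mono_nat (by omega))
  convert h with c
  generalize init c = b
  induction k c generalizing b with
  | zero => rfl
  | succ n ih => simp [List.replicate_succ, ih]

theorem add {f g : γ → ℕ} (hf : PolyTime f) (hg : PolyTime g) : PolyTime fun c => f c + g c := by
  have h : PolyTime fun c => (fun b => b + 1)^[g c] (f c) :=
    iterate hg hf (add_one snd) 2 (by
      intro c b; simp only [esize_nat, Polynomial.eval_ofNat]; omega)
  simpa [Nat.succ_iterate] using h

theorem sub {f g : γ → ℕ} (hf : PolyTime f) (hg : PolyTime g) : PolyTime fun c => f c - g c := by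
  have h : PolyTime fun c => (fun b => b - 1)^[g c] (f c) :=
    iterate hg hf (pred snd) 0 (by
      intro c b; simp only [esize_nat]; omega)
  simpa only [← Nat.pred_eq_sub_one, Nat.pred_iterate] using h

theorem decide_le {f g : γ → ℕ} (hf : PolyTime f) (hg : PolyTime g) :
    PolyTime fun c => decide (f c ≤ g c) := by
  have h : PolyTime fun c => (List.replicate (f c - g c) ()).isEmpty := (hf.sub hg).replicate.isEmpty
  convert h with c
  rw [Bool.eq_iff_iff]
  simp [Nat.sub_eq_zero_iff_le]

theorem decide_lt {f g : γ → ℕ} (hf : PolyTime f) (hg : PolyTime g) :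
    PolyTime fun c => decide (f c < g c) := decide_le hf.add_one hg

theorem decide_eq {f g : γ → ℕ} (hf : PolyTime f) (hg : PolyTime g) :
    PolyTime fun c => decide (f c = g c) := by
  have h : PolyTime fun c => decide (f c ≤ g c) && decide (g c ≤ f c) :=
    (decide_le hf hg).and (decide_le hg hf)
  convert h with c
  rw [Bool.eq_iff_iff]
  simp [Nat.le_antisymm_iff]

theorem range {f : γ → ℕ} (hf : PolyTime f) : PolyTime fun c => List.range (f c) := by
  have key : ∀ n : ℕ, (List.replicate n ()).foldl (fun l _ => l ++ [l.length]) [] =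
      List.range n := by
    intro n
    induction n with
    | zero => rfl
    | succ n ih => rw [List.replicate_succ', List.foldl_append, ih]; simp [List.range_succ]
  obtain ⟨R, hR⟩ := hf.exists_esize_le
  have h : PolyTime fun c => (List.replicate (f c) ()).foldl (fun l _ => l ++ [l.length]) [] :=
    foldl hf.replicate (const []) (append (fst.comp snd) (cons (length (fst.comp snd)) (const [])))
      (R * (2 * R + 1 + 1) + 1) (by
        intro c l' hl'
        have h1 := hR c
        rw [esize_nat] at h1
        obtain ⟨k, rfl⟩ : ∃ k, l' = List.replicate k () :=
          ⟨l'.length, List.eq_replicate_iff.2 ⟨rfl, fun _ _ => rfl⟩⟩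
        have h2 := hl'.length_le
        simp only [List.length_replicate] at h2
        rw [key]
        refine (esize_le_of_forall_mem (K := 2 * R.eval (esize c) + 1) ?_).trans ?_
        · intro a ha
          rw [List.mem_range] at ha
          rw [esize_nat]; omega
        · simp only [List.length_range, Polynomial.eval_add, Polynomial.eval_mul,
            Polynomial.eval_ofNat, Polynomial.eval_one]
          gcongr; omega)
  simpa [key] using h

theorem drop {k : γ → ℕ} {l : γ → List α} (hk : PolyTime k) (hl : PolyTime l) :
    PolyTime fun c => (l c).drop (k c) := by
  have h : PolyTime fun c => (List.tail)^[k c] (l c) :=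
    iterate hk hl (listTail snd) 0 (by
      intro c l
      cases l <;> simp only [List.tail, esize_cons] <;> omega)
  convert h with c
  generalize l c = l'
  induction k c generalizing l' with
  | zero => rfl
  | succ n ih => rw [Function.iterate_succ_apply, ← ih, List.drop_tail]

theorem take {k : γ → ℕ} {l : γ → List α} (hk : PolyTime k) (hl : PolyTime l) :
    PolyTime fun c => (l c).take (k c) := by
  have h : PolyTime fun c => ((l c).reverse.drop ((l c).length - k c)).reverse :=
    (drop (hl.length.sub hk) hl.reverse).reverse
  convert h with c
  rw [← List.reverse_take, List.reverse_reverse]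

theorem getD {k : γ → ℕ} {l : γ → List α} (hl : PolyTime l) (hk : PolyTime k) (d : α) :
    PolyTime fun c => (l c).getD (k c) d := by
  have h : PolyTime fun c => ((l c).drop (k c)).headD d := headD (drop hk hl) d
  convert h with c
  simp [List.getD_eq_getElem?_getD, List.headD_eq_head?_getD]

theorem div_two {f : γ → ℕ} (hf : PolyTime f) : PolyTime fun c => f c / 2 := by
  have h : PolyTime fun c => ((fun x : ℕ × Bool => if x.2 = true then (x.1 + 1, false)
      else (x.1, true))^[f c] (0, false)).1 :=
    fst' (iterate hf (const _) (ite (by simpa using snd' snd) (pair (add_one (fst' snd)) (const _))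
      (pair (fst' snd) (const _))) 4 (by
        rintro c ⟨n, b⟩
        cases b
        · simp [esize_true, esize_false]; omega
        · simp [esize_true, esize_false]; omega))
  have key : ∀ n : ℕ, (fun x : ℕ × Bool => if x.2 = true then (x.1 + 1, false)
      else (x.1, true))^[n] (0, false) = (n / 2, decide (n % 2 = 1)) := by
    intro n
    induction n with
    | zero => rfl
    | succ n ih =>
      rw [Function.iterate_succ_apply', ih]
      rcases Nat.mod_two_eq_zero_or_one n with h | h
      · simp [h]; omega
      · simp [h]; omega
  simpa [key] using h

theorem div_two_pow {f k : γ → ℕ} (hf : PolyTime f) (hk : PolyTime k) :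
    PolyTime fun c => f c / 2 ^ k c := by
  have h : PolyTime fun c => (fun n => n / 2)^[k c] (f c) :=
    iterate hk hf (div_two snd) 0 (by intro c n; simp only [esize_nat]; omega)
  convert h with c
  generalize f c = n
  induction k c generalizing n with
  | zero => simp
  | succ k ih => rw [Function.iterate_succ_apply, ← ih, pow_succ', Nat.div_div_eq_div_mul]

theorem clog_two {f : γ → ℕ} (hf : PolyTime f) : PolyTime fun c => Nat.clog 2 (f c) := by
  let g : ℕ × ℕ → ℕ × ℕ := fun x => if x.2 ≤ 1 then x else (x.1 + 1, (x.2 + 1) / 2)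
  have h : PolyTime fun c => (g^[f c] (0, f c)).1 :=
    fst' (iterate hf ((const 0).pair hf) (ite (decide_le (snd' snd) (const 1)) snd
      (pair (add_one (fst' snd)) (div_two (add_one (snd' snd))))) 4 (by
        rintro c ⟨n, m⟩
        simp only [g]
        split_ifs
        · omega
        · simp only [esize_pair, esize_nat, Polynomial.eval_ofNat]; omega))
  have key : ∀ k a n : ℕ, n ≤ k → (g^[k] (a, n)).1 = a + Nat.clog 2 n := by
    intro k
    induction k with
    | zero => intro a n h; obtain rfl : n = 0 := by omega
              simp
    | succ k ih =>
      intro a n h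
      rw [Function.iterate_succ_apply]
      by_cases hn : n ≤ 1
      · rw [show g (a, n) = (a, n) by simp [g, hn]]
        rcases Nat.eq_zero_or_pos k with rfl | hk
        · simp [Nat.clog_of_right_le_one hn]
        · exact ih a n (by omega)
      · rw [show g (a, n) = (a + 1, (n + 1) / 2) by simp [g, hn], ih _ _ (by omega),
          Nat.clog_of_two_le (n := n) one_lt_two (by omega)]
        simp only [show n + 2 - 1 = n + 1 by omega]; omega
  simpa [key] using h

end PolyTime

/-! ### The algorithms -/

/-- Triples of numbers name the vertices of the subdivision and the nodes of the binary tree onto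
which it is folded: `(u, u, 0)` is the vertex `u` of the original graph, `(u, v, k)` with `u < v` and
`1 ≤ k ≤ 2 L` is the `k`-th subdivision vertex of the edge `uv`, counted from `u`, and `(j, j, i)` is
the `j`-th tree node of level `i`. -/
abbrev Label : Type := ℕ × ℕ × ℕ

/-- The entry of a 0/1-matrix, `false` outside of the matrix. -/
def matAdj (M : List (List Bool)) (u v : ℕ) : Bool := (M.getD u []).getD v false

/-- The edges `uv` with `u < v` of the graph with adjacency matrix `M`. -/
def edgeList (M : List (List Bool)) : List (ℕ × ℕ) :=
  (List.range M.length).flatMap fun u =>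
    ((List.range M.length).filter fun v => decide (u < v) && matAdj M u v).map fun v => (u, v)

/-- The subdivision vertices, edge by edge, if each edge of `E` is subdivided `2 L` times. -/
def innerList (L : ℕ) (E : List (ℕ × ℕ)) : List Label :=
  E.flatMap fun e => (List.range (2 * L)).map fun k => (e.1, e.2, k + 1)

/-- All vertices of the subdivision of a graph with `n` vertices and edges `E`. -/
def vertexList (n L : ℕ) (E : List (ℕ × ℕ)) : List Label :=
  (List.range n).map (fun u => (u, u, 0)) ++ innerList L E

/-- The vertex `y` of the subdivision is the next one after `x` on some subdivided edge, or the first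
one next to an original vertex `x`. -/
def linkTest (L : ℕ) (x y : Label) : Bool :=
  (decide (x.1 < x.2.1) && (decide (x.1 = y.1) && (decide (x.2.1 = y.2.1) &&
    decide (x.2.2 + 1 = y.2.2)))) ||
  (decide (x.1 = x.2.1) && (decide (y.1 < y.2.1) &&
    ((decide (x.1 = y.1) && decide (y.2.2 = 1)) ||
      (decide (x.1 = y.2.1) && decide (y.2.2 = 2 * L)))))

/-- Adjacency of vertices of the subdivision. -/
def linkAdj (L : ℕ) (x y : Label) : Bool := linkTest L x y || linkTest L y x

/-- The tree node onto which a vertex of the subdivision is folded. -/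
def foldNode (L : ℕ) (x : Label) : Label :=
  if x.2.2 ≤ L then (x.1 / 2 ^ x.2.2, x.1 / 2 ^ x.2.2, x.2.2)
  else (x.2.1 / 2 ^ (2 * L + 1 - x.2.2), x.2.1 / 2 ^ (2 * L + 1 - x.2.2), 2 * L + 1 - x.2.2)

/-- Replaces the label `p.1` by the label `p.2`. -/
def relabel (x : Label) (p : Label × Label) : Label := if x = p.1 then p.2 else x

/-- The replacements of labels that fold the subdivision onto the binary tree. -/
def foldSteps (L : ℕ) (E : List (ℕ × ℕ)) : List (Label × Label) :=
  (innerList L E).map fun x => (x, foldNode L x)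

/-- The replacements of labels that contract the binary tree, level by level. -/
def treeSteps (n L : ℕ) : List (Label × Label) :=
  (List.range L).flatMap fun i =>
    (List.range n).map fun j => ((j, j, i), (j / 2, j / 2, i + 1))

/-- The 0/1-matrix of a relation on a list. -/
def relMatrix {α : Type} (R : α → α → Bool) (D : List α) : List (List Bool) :=
  D.map fun x => D.map fun y => R x y

/-- The `t`-th replacement changes the partition into classes of equally labelled vertices. -/
def isMerge (D : List Label) (T : List (Label × Label)) (t : ℕ) : Bool :=
  let p := T.getD t ((0, 0, 0), (0, 0, 0))
  (!decide (p.1 = p.2)) && ((D.any fun x => decide ((T.take t).foldl relabel x = p.1)) &&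
    (D.any fun x => decide ((T.take t).foldl relabel x = p.2)))

/-- The matrices of all partitions that arise by carrying out the replacements of labels `T` one by
one, starting with the partition of `D` into singletons. -/
def mergeMatrices (D : List Label) (T : List (Label × Label)) : List (List (List Bool)) :=
  relMatrix (fun x y => decide (x = y)) D ::
    (List.range T.length).flatMap fun t =>
      if isMerge D T t = true then
        [relMatrix (fun x y => decide (x = y)) (D.map fun x => (T.take (t + 1)).foldl relabel x)]
      else []

/-- The adjacency matrix of the subdivision together with the matrices of its `4`-sequence. -/
def subdivisionInput (M : List (List Bool)) : List (List Bool) × List (List (List Bool)) :=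
  let L := Nat.clog 2 M.length
  let D := vertexList M.length L (edgeList M)
  (relMatrix (linkAdj L) D, mergeMatrices D (foldSteps L (edgeList M) ++ treeSteps M.length L))

/-- The vertices to which a depth-first search can proceed, given its stack and its list of visited
vertices. -/
def dfsNext (M : List (List Bool)) (x : List ℕ × List ℕ) : List ℕ :=
  (List.range M.length).filter fun y =>
    (!x.2.any fun z => decide (z = y)) && (x.1.isEmpty || matAdj M (x.1.headD 0) y)

/-- A step of a depth-first search: the state consists of the stack and of the list of visited
vertices. -/
def dfsStep (M : List (List Bool)) (x : List ℕ × List ℕ) : List ℕ × List ℕ :=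
  if (dfsNext M x).isEmpty = true then (x.1.tail, x.2)
  else ((dfsNext M x).headD 0 :: x.1, (dfsNext M x).headD 0 :: x.2)

/-- All stacks that occur in a depth-first search. -/
def dfsStacks (M : List (List Bool)) : List (List ℕ) :=
  (List.range (2 * M.length + 1)).map fun t => ((dfsStep M)^[t] ([], [])).1

/-- A longest one of the given lists. -/
def longest (l : List (List ℕ)) : List ℕ :=
  l.foldl (fun a b => if a.length < b.length then b else a) []

/-- The longer one of the path on the original vertices of a path of the subdivision and of the
longest path found by depth-first search. -/
def extractPath (M : List (List Bool)) (q : List ℕ) : List ℕ :=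
  longest ((q.filter fun i => decide (i < M.length)) :: dfsStacks M)

/-! ### The algorithms run in polynomial time -/

namespace PolyTime

variable {α γ : Type} [Enc α] [Enc γ]

theorem matAdj {M : γ → List (List Bool)} {u v : γ → ℕ} (hM : PolyTime M) (hu : PolyTime u)
    (hv : PolyTime v) : PolyTime fun c => matAdj (M c) (u c) (v c) :=
  getD (getD hM hu []) hv false

theorem edgeList : PolyTime edgeList :=
  flatMap (range (length id)) (map (filter (range (length fst))
    ((decide_lt (snd' fst) snd).and (matAdj (fst' fst) (snd' fst) snd)))
      (pair (snd' fst) snd))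

theorem two_mul {f : γ → ℕ} (hf : PolyTime f) : PolyTime fun c => 2 * f c := by
  simpa only [Nat.two_mul] using hf.add hf

theorem innerList {L : γ → ℕ} {E : γ → List (ℕ × ℕ)} (hL : PolyTime L) (hE : PolyTime E) :
    PolyTime fun c => innerList (L c) (E c) :=
  flatMap hE (map (range (two_mul (hL.comp fst)))
    (pair (fst' (snd' fst)) (pair (snd' (snd' fst)) (add_one snd))))

theorem vertexList {n L : γ → ℕ} {E : γ → List (ℕ × ℕ)} (hn : PolyTime n) (hL : PolyTime L)
    (hE : PolyTime E) : PolyTime fun c => vertexList (n c) (L c) (E c) :=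
  append (map (range hn) (pair snd (pair snd (const 0)))) (innerList hL hE)

theorem linkTest {L : γ → ℕ} {x y : γ → Label} (hL : PolyTime L) (hx : PolyTime x)
    (hy : PolyTime y) : PolyTime fun c => linkTest (L c) (x c) (y c) :=
  ((decide_lt hx.fst' hx.snd'.fst').and ((decide_eq hx.fst' hy.fst').and
    ((decide_eq hx.snd'.fst' hy.snd'.fst').and (decide_eq hx.snd'.snd'.add_one hy.snd'.snd')))).or
  ((decide_eq hx.fst' hx.snd'.fst').and ((decide_lt hy.fst' hy.snd'.fst').and
    (((decide_eq hx.fst' hy.fst').and (decide_eq hy.snd'.snd' (const 1))).or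
      ((decide_eq hx.fst' hy.snd'.fst').and (decide_eq hy.snd'.snd' (two_mul hL))))))

theorem linkAdj {L : γ → ℕ} {x y : γ → Label} (hL : PolyTime L) (hx : PolyTime x)
    (hy : PolyTime y) : PolyTime fun c => linkAdj (L c) (x c) (y c) :=
  (linkTest hL hx hy).or (linkTest hL hy hx)

theorem foldNode {L : γ → ℕ} {x : γ → Label} (hL : PolyTime L) (hx : PolyTime x) :
    PolyTime fun c => foldNode (L c) (x c) := by
  have h1 := div_two_pow hx.fst' hx.snd'.snd'
  have h2 := (two_mul hL).add_one.sub hx.snd'.snd'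
  have h3 := div_two_pow hx.snd'.fst' h2
  exact ite (decide_le hx.snd'.snd' hL) (h1.pair (h1.pair hx.snd'.snd')) (h3.pair (h3.pair h2))

theorem decide_label_eq {x y : γ → Label} (hx : PolyTime x) (hy : PolyTime y) :
    PolyTime fun c => decide (x c = y c) := by
  have h := (decide_eq hx.fst' hy.fst').and ((decide_eq hx.snd'.fst' hy.snd'.fst').and
    (decide_eq hx.snd'.snd' hy.snd'.snd'))
  convert h with c
  simp only [Prod.ext_iff, Bool.decide_and]

theorem relabel {x : γ → Label} {p : γ → Label × Label} (hx : PolyTime x) (hp : PolyTime p) :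
    PolyTime fun c => relabel (x c) (p c) :=
  ite (decide_label_eq hx hp.fst') hp.snd' hx

theorem foldl_relabel {x : γ → Label} {T : γ → List (Label × Label)} (hx : PolyTime x)
    (hT : PolyTime T) : PolyTime fun c => (T c).foldl _root_.relabel (x c) := by
  obtain ⟨P, hP⟩ := hx.exists_esize_le
  obtain ⟨Q, hQ⟩ := hT.exists_esize_le
  refine foldl (step := fun _ => _root_.relabel) hT hx (relabel (fst' snd) (snd' snd)) (P + Q)
    fun c l' hl' => ?_
  have key : ∀ (l : List (Label × Label)) y, esize (l.foldl _root_.relabel y) ≤ esize y + esize l := by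
    intro l
    induction l with
    | nil => intro y; simp
    | cons p l ih =>
      intro y
      refine (ih _).trans ?_
      rw [esize_cons, show esize p = esize p.1 + esize p.2 + 1 from rfl, _root_.relabel]
      split_ifs <;> omega
  have h1 := key l' (x c)
  have h2 := esize_le_of_prefix hl'
  have h3 := hP c
  have h4 := hQ c
  rw [Polynomial.eval_add]
  omega

theorem foldSteps {L : γ → ℕ} {E : γ → List (ℕ × ℕ)} (hL : PolyTime L) (hE : PolyTime E) :
    PolyTime fun c => foldSteps (L c) (E c) :=
  map (innerList hL hE) (pair snd (foldNode (hL.comp fst) snd))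

theorem treeSteps {n L : γ → ℕ} (hn : PolyTime n) (hL : PolyTime L) :
    PolyTime fun c => treeSteps (n c) (L c) :=
  flatMap (range hL) (map (range (hn.comp fst))
    (((snd.pair (snd.pair (snd' fst)))).pair
      ((div_two snd).pair ((div_two snd).pair (snd' fst).add_one))))

theorem relMatrix {R : γ → α → α → Bool} {D : γ → List α}
    (hR : PolyTime fun x : γ × α × α => R x.1 x.2.1 x.2.2) (hD : PolyTime D) :
    PolyTime fun c => relMatrix (R c) (D c) :=
  map hD (map (hD.comp fst) (hR.comp ((fst' fst).pair ((snd' fst).pair snd))))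

theorem isMerge {D : γ → List Label} {T : γ → List (Label × Label)} {t : γ → ℕ} (hD : PolyTime D)
    (hT : PolyTime T) (ht : PolyTime t) : PolyTime fun c => isMerge (D c) (T c) (t c) := by
  have hp := getD hT ht ((0, 0, 0), (0, 0, 0))
  have hx : PolyTime fun c : γ × Label => ((T c.1).take (t c.1)).foldl _root_.relabel c.2 :=
    foldl_relabel snd ((take ht hT).comp fst)
  exact (decide_label_eq hp.fst' hp.snd').not.and
    ((any hD (decide_label_eq hx (hp.comp fst).fst')).and
      (any hD (decide_label_eq hx (hp.comp fst).snd')))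

theorem mergeMatrices {D : γ → List Label} {T : γ → List (Label × Label)} (hD : PolyTime D)
    (hT : PolyTime T) : PolyTime fun c => mergeMatrices (D c) (T c) :=
  cons (relMatrix (decide_label_eq (fst' snd) (snd' snd)) hD)
    (flatMap (range (length hT)) (ite
      (by simpa using isMerge (hD.comp fst) (hT.comp fst) snd)
      (cons (relMatrix (decide_label_eq (fst' snd) (snd' snd)) (map (hD.comp fst)
        (foldl_relabel snd (take (snd' fst).add_one (hT.comp (fst' fst)))))) (const []))
      (const [])))

theorem relMatrix_linkAdj {L : γ → ℕ} {D : γ → List Label} (hL : PolyTime L) (hD : PolyTime D) :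
    PolyTime fun c => _root_.relMatrix (_root_.linkAdj (L c)) (D c) :=
  relMatrix (linkAdj (hL.comp fst) (fst' snd) (snd' snd)) hD

theorem subdivisionInput : PolyTime subdivisionInput := by
  have hn : PolyTime fun M : List (List Bool) => M.length := length id
  have hL : PolyTime fun M : List (List Bool) => Nat.clog 2 M.length := clog_two hn
  have hD := vertexList hn hL edgeList
  exact pair (relMatrix_linkAdj hL hD)
    (mergeMatrices hD (append (foldSteps hL edgeList) (treeSteps hn hL)))

theorem dfsNext {M : γ → List (List Bool)} {x : γ → List ℕ × List ℕ} (hM : PolyTime M)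
    (hx : PolyTime x) : PolyTime fun c => dfsNext (M c) (x c) :=
  filter (range (length hM)) ((any (hx.comp fst).snd' (decide_eq snd (snd' fst))).not.and
    ((hx.comp fst).fst'.isEmpty.or
      (matAdj (hM.comp fst) ((hx.comp fst).fst'.headD 0) snd)))

theorem dfsStep {M : γ → List (List Bool)} {x : γ → List ℕ × List ℕ} (hM : PolyTime M)
    (hx : PolyTime x) : PolyTime fun c => dfsStep (M c) (x c) := by
  have h := dfsNext hM hx
  exact ite (by simpa only [Bool.decide_eq_true] using h.isEmpty) (hx.fst'.listTail.pair hx.snd')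
    (((h.headD 0).cons hx.fst').pair ((h.headD 0).cons hx.snd'))

theorem dfsStacks {M : γ → List (List Bool)} (hM : PolyTime M) :
    PolyTime fun c => dfsStacks (M c) := by
  obtain ⟨R, hR⟩ := hM.exists_esize_le
  refine map (range (two_mul (length hM)).add_one) (fst' (iterate
    (f := fun c : γ × ℕ => _root_.dfsStep (M c.1)) snd (const _)
      (dfsStep (hM.comp (fst' fst)) snd) (4 * R + 4) ?_))
  rintro ⟨c, t⟩ ⟨S, V⟩
  have h1 : R.eval (esize c) ≤ R.eval (esize (c, t)) :=
    R.eval_mono_nat (by rw [esize_pair]; omega)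
  have h2 := (length_lt_esize (M c)).trans_le (hR c)
  have h3 : (_root_.dfsNext (M c) (S, V)).headD 0 ≤ (M c).length := by
    rcases h : _root_.dfsNext (M c) (S, V) with _ | ⟨y, l⟩
    · simp
    · have : y ∈ _root_.dfsNext (M c) (S, V) := by simp [h]
      exact (List.mem_range.1 (List.mem_filter.1 this).1).le
  simp only [_root_.dfsStep, Polynomial.eval_add, Polynomial.eval_mul, Polynomial.eval_ofNat]
  split_ifs
  · rcases S with _ | ⟨y, S⟩ <;> simp only [esize_pair, List.tail, esize_cons] <;> omega
  · simp only [esize_pair, esize_cons, esize_nat] at *; omega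

theorem longest {l : γ → List (List ℕ)} (hl : PolyTime l) : PolyTime fun c => longest (l c) :=
  foldl_of_add_le hl (const []) (ite (decide_lt (length (fst' snd)) (length (snd' snd)))
    (snd' snd) (fst' snd)) Polynomial.X (by
      intro c a b _
      rw [Polynomial.eval_X]
      split_ifs <;> omega)

theorem extractPath : PolyTime fun x : List (List Bool) × List ℕ => extractPath x.1 x.2 :=
  longest (cons (filter snd (decide_lt snd (length (fst' fst)))) (dfsStacks fst))

end PolyTime

/-! ### Partition sequences from labellings -/

/-- The partitions that belong to `mergeMatrices D T`. -/
def mergeSeq (D : List Label) (T : List (Label × Label)) (m : ℕ) : List (Setoid (Fin D.length)) :=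
  Setoid.ker D.get :: (List.range m).flatMap fun t =>
    if isMerge D T t = true then
      [Setoid.ker fun i => (T.take (t + 1)).foldl relabel (D.get i)] else []

theorem mergesTo_relabel {V : Type*} {f : V → Label} {p : Label × Label} (hp : p.1 ≠ p.2)
    (h₁ : ∃ u, f u = p.1) (h₂ : ∃ v, f v = p.2) :
    MergesTo (Setoid.ker f) (Setoid.ker fun v => relabel (f v) p) := by
  obtain ⟨u, hu⟩ := h₁
  obtain ⟨v, hv⟩ := h₂
  refine ⟨u, v, fun h => hp (hu ▸ hv ▸ h), fun x y => ?_⟩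
  change relabel (f x) p = relabel (f y) p ↔ f x = f y ∨ (f x = f u ∧ f y = f v) ∨
    (f x = f v ∧ f y = f u)
  unfold relabel
  grind

theorem ker_relabel {V : Type*} {f : V → Label} {p : Label × Label}
    (h : p.1 ≠ p.2 → (∃ u, f u = p.1) → ¬ ∃ v, f v = p.2) :
    Setoid.ker (fun v => relabel (f v) p) = Setoid.ker f := by
  ext x y
  change relabel (f x) p = relabel (f y) p ↔ f x = f y
  have h' : ∀ u v, p.1 ≠ p.2 → f u = p.1 → f v ≠ p.2 := fun u v hp hu hv => h hp ⟨u, hu⟩ ⟨v, hv⟩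
  have h₁ := h' x y
  have h₂ := h' y x
  unfold relabel
  grind

theorem isMerge_iff {D : List Label} {T : List (Label × Label)} {t : ℕ} (ht : t < T.length) :
    isMerge D T t = true ↔ T[t].1 ≠ T[t].2 ∧
      (∃ i : Fin D.length, (T.take t).foldl relabel (D.get i) = T[t].1) ∧
      ∃ i : Fin D.length, (T.take t).foldl relabel (D.get i) = T[t].2 := by
  have h : ∀ P : Label → Prop, (∃ x ∈ D, P x) ↔ ∃ i : Fin D.length, P (D.get i) := by
    intro P
    simp only [List.mem_iff_get]
    grind
  simp only [isMerge, List.getD_eq_getElem _ _ ht, Bool.and_eq_true, Bool.not_eq_true',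
    decide_eq_false_iff_not, List.any_eq_true, decide_eq_true_eq, h, ne_eq]

theorem foldl_take_succ {T : List (Label × Label)} {t : ℕ} (ht : t < T.length) (x : Label) :
    (T.take (t + 1)).foldl relabel x = relabel ((T.take t).foldl relabel x) T[t] := by
  rw [List.take_add_one, List.getElem?_eq_getElem ht, Option.toList_some, List.foldl_append]
  rfl

theorem mergeSeq_isChain (D : List Label) (T : List (Label × Label)) {m : ℕ} (hm : m ≤ T.length) :
    (mergeSeq D T m).IsChain MergesTo ∧
      (mergeSeq D T m).getLast? =
        some (Setoid.ker fun i => (T.take m).foldl relabel (D.get i)) := by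
  induction m with
  | zero => simp [mergeSeq]; rfl
  | succ m ih =>
    obtain ⟨ih₁, ih₂⟩ := ih (by omega)
    have hs : mergeSeq D T (m + 1) = mergeSeq D T m ++ if isMerge D T m = true then
        [Setoid.ker fun i => (T.take (m + 1)).foldl relabel (D.get i)] else [] := by
      simp [mergeSeq, List.range_succ]
    rw [hs]
    have hf : (fun i => (T.take (m + 1)).foldl relabel (D.get i)) =
        fun i => relabel ((T.take m).foldl relabel (D.get i)) T[m] :=
      funext fun i => foldl_take_succ (by omega) _
    by_cases h : isMerge D T m = true
    · rw [if_pos h]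
      obtain ⟨h₁, h₂, h₃⟩ := (isMerge_iff (by omega)).1 h
      refine ⟨List.isChain_append.2 ⟨ih₁, .singleton _, ?_⟩, by simp⟩
      intro a ha b hb
      rw [ih₂, Option.mem_some_iff] at ha
      simp only [List.head?_cons, Option.mem_some_iff] at hb
      rw [← ha, ← hb, hf]
      exact mergesTo_relabel h₁ h₂ h₃
    · rw [if_neg h, List.append_nil]
      refine ⟨ih₁, ?_⟩
      rw [ih₂, hf, ker_relabel]
      rw [isMerge_iff (by omega)] at h
      tauto

theorem mem_mergeSeq {D : List Label} {T : List (Label × Label)} {m : ℕ}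
    {s : Setoid (Fin D.length)} (hs : s ∈ mergeSeq D T m) :
    ∃ t ≤ m, s = Setoid.ker fun i => (T.take t).foldl relabel (D.get i) := by
  rcases List.mem_cons.1 hs with rfl | hs
  · exact ⟨0, by omega, by simp; rfl⟩
  · obtain ⟨t, ht, hs⟩ := List.mem_flatMap.1 hs
    rw [List.mem_range] at ht
    split_ifs at hs
    · exact ⟨t + 1, by omega, List.mem_singleton.1 hs⟩
    · simp at hs

/-- The red degrees of the partition into classes of equally labelled vertices are bounded by the
number of labels that a red neighbour can have. -/
theorem redDegree_ker_le {V : Type*} {G : SimpleGraph V} {f : V → Label} {d : ℕ}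
    (h : ∀ v, ∃ F : Finset Label, F.card ≤ d ∧ ∀ x y x' y', f x = f v → f x' = f v → f y ≠ f v →
      f y' = f y → G.Adj x y → ¬ G.Adj x' y' → f y ∈ F) (P : Quotient (Setoid.ker f)) :
    redDegree G (Setoid.ker f) P ≤ d := by
  obtain ⟨v, rfl⟩ := Quotient.exists_rep P
  obtain ⟨F, hF, h⟩ := h v
  have hinj : Function.Injective (Quotient.lift (s := Setoid.ker f) f fun _ _ h => h) := by
    rintro ⟨a⟩ ⟨b⟩ h
    exact Quotient.sound h
  refine le_trans ?_ hF
  rw [← Set.ncard_coe_finset]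
  refine Set.ncard_le_ncard_of_injOn _ ?_ hinj.injOn F.finite_toSet
  rintro Q ⟨hQ, ⟨x, y, hx, rfl, hxy⟩, ⟨x', y', hx', hy', hn⟩⟩
  refine h x y x' y' (Quotient.exact hx) (Quotient.exact hx') (fun e => hQ (Quotient.sound e))
    (Quotient.exact hy') hxy hn

theorem isTwinSequence_mergeSeq {D : List Label} (hD : D.Nodup) {T : List (Label × Label)} {d : ℕ}
    {H : SimpleGraph (Fin D.length)} {c : Label} (hc : ∀ x ∈ D, T.foldl relabel x = c)
    (hred : ∀ t ≤ T.length, ∀ v, ∃ F : Finset Label, F.card ≤ d ∧ ∀ x y x' y',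
      (T.take t).foldl relabel (D.get x) = (T.take t).foldl relabel (D.get v) →
      (T.take t).foldl relabel (D.get x') = (T.take t).foldl relabel (D.get v) →
      (T.take t).foldl relabel (D.get y) ≠ (T.take t).foldl relabel (D.get v) →
      (T.take t).foldl relabel (D.get y') = (T.take t).foldl relabel (D.get y) →
      H.Adj x y → ¬ H.Adj x' y' → (T.take t).foldl relabel (D.get y) ∈ F) :
    IsTwinSequence H d (mergeSeq D T T.length) := by
  obtain ⟨h₁, h₂⟩ := mergeSeq_isChain D T le_rfl
  refine ⟨?_, ?_, h₁, ?_⟩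
  · simp only [mergeSeq, List.head?_cons, Option.some.injEq]
    ext i j
    exact (List.nodup_iff_injective_get.1 hD).eq_iff
  · rw [h₂, Option.some.injEq, List.take_length]
    ext i j
    refine iff_of_true ?_ trivial
    exact (hc _ (List.get_mem _ _)).trans (hc _ (List.get_mem _ _)).symm
  · intro s hs P
    obtain ⟨t, ht, rfl⟩ := mem_mergeSeq hs
    exact redDegree_ker_le (hred t ht) P

/-! ### The subdivision -/

/-- The `k`-th vertex, `0 ≤ k ≤ 2 L + 1`, on the subdivided edge between `a` and `b`, counted from
`a`. -/
def arcVertex (L a b k : ℕ) : Label :=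
  if k = 0 then (a, a, 0) else if k = 2 * L + 1 then (b, b, 0)
  else if a < b then (a, b, k) else (b, a, 2 * L + 1 - k)

theorem arcVertex_zero (L a b : ℕ) : arcVertex L a b 0 = (a, a, 0) := rfl

theorem arcVertex_last (L a b : ℕ) : arcVertex L a b (2 * L + 1) = (b, b, 0) := by
  simp [arcVertex]

theorem arcVertex_symm {L a b k : ℕ} (hab : a ≠ b) (hk : k ≤ 2 * L + 1) :
    arcVertex L b a (2 * L + 1 - k) = arcVertex L a b k := by
  unfold arcVertex
  split_ifs <;> first | rfl | omega | (simp only [Prod.mk.injEq, true_and]; omega)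

theorem arcVertex_of_lt {L a b k : ℕ} (hab : a < b) (hk : 1 ≤ k) (hk' : k ≤ 2 * L) :
    arcVertex L a b k = (a, b, k) := by
  unfold arcVertex
  split_ifs <;> first | rfl | omega

theorem arcVertex_inner_eq {L a b k a' b' k' : ℕ} (hk : 1 ≤ k)
    (hk' : k ≤ 2 * L) (h : arcVertex L a b k = arcVertex L a' b' k') (h' : k' ≤ 2 * L + 1) :
    (a' = a ∧ b' = b ∧ k' = k) ∨ (a' = b ∧ b' = a ∧ k' = 2 * L + 1 - k) := by
  unfold arcVertex at h
  split_ifs at h <;> simp only [Prod.mk.injEq] at h <;> omega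

/-- `g` is a graph on `{0, …, n - 1}`, each of whose edges occurs once in the list `E`, with its smaller
end first, and `2 ^ L` is at least `n`, so that `n` vertices fit on the leaves of a
binary tree of height `L`. -/
structure EdgeListed (g : SimpleGraph ℕ) (n L : ℕ) (E : List (ℕ × ℕ)) : Prop where
  lt : ∀ {a b}, g.Adj a b → a < n
  le_pow : n ≤ 2 ^ L
  mem_iff : ∀ {u v}, (u, v) ∈ E ↔ u < v ∧ g.Adj u v
  nodup : E.Nodup

namespace EdgeListed

variable {g : SimpleGraph ℕ} {n L : ℕ} {E : List (ℕ × ℕ)}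

theorem one_le (h : EdgeListed g n L E) {a b : ℕ} (hab : g.Adj a b) : 1 ≤ L := by
  have h1 := h.lt hab
  have h2 := h.lt hab.symm
  have h3 := hab.ne
  have h4 := h.le_pow
  by_contra h5
  obtain rfl : L = 0 := by omega
  simp at h4
  omega

end EdgeListed

theorem mem_innerList {L : ℕ} {E : List (ℕ × ℕ)} {x : Label} :
    x ∈ innerList L E ↔ ∃ u v k, (u, v) ∈ E ∧ 1 ≤ k ∧ k ≤ 2 * L ∧ x = (u, v, k) := by
  simp only [innerList, List.mem_flatMap, List.mem_map, List.mem_range, Prod.exists]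
  constructor
  · rintro ⟨u, v, h, k, hk, rfl⟩
    exact ⟨u, v, k + 1, h, by omega, by omega, rfl⟩
  · rintro ⟨u, v, k, h, h1, h2, rfl⟩
    exact ⟨u, v, h, k - 1, by omega, by simp; omega⟩

theorem mem_vertexList {n L : ℕ} {E : List (ℕ × ℕ)} {x : Label} :
    x ∈ vertexList n L E ↔ (∃ u < n, x = (u, u, 0)) ∨ x ∈ innerList L E := by
  simp only [vertexList, List.mem_append, List.mem_map, List.mem_range, eq_comm]

theorem length_vertexList (n L : ℕ) (E : List (ℕ × ℕ)) :
    (vertexList n L E).length = n + 2 * L * E.length := by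
  simp [vertexList, innerList, List.length_flatMap, mul_comm]

theorem linkAdj_comm (L : ℕ) (x y : Label) : linkAdj L x y = linkAdj L y x := by
  unfold linkAdj; rw [Bool.or_comm]

theorem linkTest_iff {L : ℕ} {x y : Label} : linkTest L x y = true ↔
    (x.1 < x.2.1 ∧ x.1 = y.1 ∧ x.2.1 = y.2.1 ∧ x.2.2 + 1 = y.2.2) ∨
    (x.1 = x.2.1 ∧ y.1 < y.2.1 ∧ ((x.1 = y.1 ∧ y.2.2 = 1) ∨ (x.1 = y.2.1 ∧ y.2.2 = 2 * L))) := by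
  simp [linkTest]

namespace EdgeListed

variable {g : SimpleGraph ℕ} {n L : ℕ} {E : List (ℕ × ℕ)}

theorem nodup_innerList (h : EdgeListed g n L E) : (innerList L E).Nodup := by
  refine List.nodup_flatMap.2 ⟨fun e _ => ?_, ?_⟩
  · exact List.nodup_range.map fun a b hab => by simpa using hab
  · refine h.nodup.imp fun {e e'} hne => ?_
    intro x hx hx'
    simp only [List.mem_map] at hx hx'
    obtain ⟨k, _, rfl⟩ := hx
    obtain ⟨k', _, hk⟩ := hx'
    simp only [Prod.mk.injEq] at hk
    exact hne (Prod.ext hk.1.symm hk.2.1.symm)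

theorem fst_lt (h : EdgeListed g n L E) {x : Label} (hx : x ∈ innerList L E) : x.1 < x.2.1 := by
  obtain ⟨u, v, k, he, -, -, rfl⟩ := mem_innerList.1 hx
  exact (h.mem_iff.1 he).1

theorem nodup_vertexList (h : EdgeListed g n L E) : (vertexList n L E).Nodup := by
  refine List.nodup_append.2 ⟨List.nodup_range.map fun a b hab => by simpa using hab,
    h.nodup_innerList, fun x hx y hy hxy => ?_⟩
  subst hxy
  obtain ⟨u, -, rfl⟩ := List.mem_map.1 hx
  exact lt_irrefl _ (h.fst_lt hy)

theorem arcVertex_mem_innerList (h : EdgeListed g n L E) {a b k : ℕ} (hab : g.Adj a b)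
    (hk : 1 ≤ k) (hk' : k ≤ 2 * L) : arcVertex L a b k ∈ innerList L E := by
  wlog hlt : a < b generalizing a b k
  · rw [← arcVertex_symm hab.ne (by omega)]
    have hne := hab.ne
    exact this hab.symm (by omega) (by omega) (by omega)
  rw [arcVertex_of_lt hlt hk hk']
  exact mem_innerList.2 ⟨a, b, k, h.mem_iff.2 ⟨hlt, hab⟩, hk, hk', rfl⟩

theorem arcVertex_mem (h : EdgeListed g n L E) {a b k : ℕ} (hab : g.Adj a b)
    (hk' : k ≤ 2 * L + 1) : arcVertex L a b k ∈ vertexList n L E := by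
  rw [mem_vertexList]
  rcases Nat.eq_zero_or_pos k with rfl | hk
  · exact .inl ⟨a, h.lt hab, rfl⟩
  · rcases hk'.eq_or_lt with rfl | hk'
    · exact .inl ⟨b, h.lt hab.symm, arcVertex_last L a b⟩
    · exact .inr (h.arcVertex_mem_innerList hab hk (by omega))

theorem linkAdj_arcVertex (h : EdgeListed g n L E) {a b k : ℕ} (hab : g.Adj a b)
    (hk : k ≤ 2 * L) : linkAdj L (arcVertex L a b k) (arcVertex L a b (k + 1)) = true := by
  wlog hlt : a < b generalizing a b k
  · rw [← arcVertex_symm hab.ne (by omega), ← arcVertex_symm (k := k + 1) hab.ne (by omega),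
      linkAdj_comm]
    have hne := hab.ne
    have := this hab.symm (k := 2 * L + 1 - (k + 1)) (by omega) (by omega)
    rwa [show 2 * L + 1 - (k + 1) + 1 = 2 * L + 1 - k by omega] at this
  have hL := h.one_le hab
  rw [linkAdj, Bool.or_eq_true, linkTest_iff, linkTest_iff]
  rcases Nat.eq_zero_or_pos k with rfl | hk0
  · rw [arcVertex_zero, arcVertex_of_lt hlt (by omega) (by omega)]
    simp [hlt]
  · rcases hk.eq_or_lt with rfl | hk'
    · rw [arcVertex_last, arcVertex_of_lt hlt (by omega) (by omega)]
      simp [hlt]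
    · rw [arcVertex_of_lt hlt (by omega) (by omega), arcVertex_of_lt hlt (by omega) (by omega)]
      simp [hlt]

theorem exists_arc_of_linkTest (h : EdgeListed g n L E) {x y : Label} (hx : x ∈ vertexList n L E)
    (hy : y ∈ vertexList n L E) (hxy : linkTest L x y = true) :
    ∃ a b k, g.Adj a b ∧ k ≤ 2 * L ∧ x = arcVertex L a b k ∧ y = arcVertex L a b (k + 1) := by
  rw [mem_vertexList, mem_innerList] at hx hy
  rw [linkTest_iff] at hxy
  rcases hx with ⟨u, hu, rfl⟩ | ⟨u, v, k, he, hk, hk', rfl⟩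
  · rcases hy with ⟨u', hu', rfl⟩ | ⟨u', v', k', he', hk, hk', rfl⟩
    · simp at hxy
    · obtain ⟨hlt, hab⟩ := h.mem_iff.1 he'
      simp only [lt_irrefl, false_and, false_or, true_and] at hxy
      obtain ⟨-, ⟨rfl, rfl⟩ | ⟨rfl, rfl⟩⟩ := hxy
      · exact ⟨u, v', 0, hab, by omega, rfl, (arcVertex_of_lt hlt hk hk').symm⟩
      · refine ⟨u, u', 0, hab.symm, by omega, rfl, ?_⟩
        rw [← arcVertex_symm hab.symm.ne (by omega), arcVertex_of_lt hlt (by omega) (by omega)]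
        simp
  · obtain ⟨hlt, hab⟩ := h.mem_iff.1 he
    rcases hy with ⟨u', hu', rfl⟩ | ⟨u', v', k', he', hk1, hk1', rfl⟩
    · simp at hxy
    · simp only [hlt, hlt.ne, true_and, false_and, or_false] at hxy
      obtain ⟨rfl, rfl, rfl⟩ := hxy
      exact ⟨u, v, k, hab, hk', (arcVertex_of_lt hlt hk hk').symm,
        (arcVertex_of_lt hlt hk1 hk1').symm⟩

theorem linkAdj_iff (h : EdgeListed g n L E) {x y : Label} (hx : x ∈ vertexList n L E)
    (hy : y ∈ vertexList n L E) : linkAdj L x y = true ↔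
      ∃ a b k, g.Adj a b ∧ k ≤ 2 * L ∧ x = arcVertex L a b k ∧ y = arcVertex L a b (k + 1) := by
  constructor
  · intro hxy
    rw [linkAdj, Bool.or_eq_true] at hxy
    rcases hxy with hxy | hxy
    · exact h.exists_arc_of_linkTest hx hy hxy
    · obtain ⟨a, b, k, hab, hk, rfl, rfl⟩ := h.exists_arc_of_linkTest hy hx hxy
      refine ⟨b, a, 2 * L - k, hab.symm, by omega, ?_, ?_⟩
      · rw [← arcVertex_symm hab.ne (by omega)]; congr 1; omega
      · rw [← arcVertex_symm hab.ne (by omega)]; congr 1; omega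
  · rintro ⟨a, b, k, hab, hk, rfl, rfl⟩
    exact h.linkAdj_arcVertex hab hk

theorem eq_of_linkAdj_inner (h : EdgeListed g n L E) {a b k : ℕ} {y : Label} (hab : g.Adj a b)
    (hk : 1 ≤ k) (hk' : k ≤ 2 * L) (hy : y ∈ vertexList n L E)
    (hl : linkAdj L (arcVertex L a b k) y = true) :
    y = arcVertex L a b (k - 1) ∨ y = arcVertex L a b (k + 1) := by
  obtain ⟨a', b', k', hab', hk1, hx, rfl⟩ :=
    (h.linkAdj_iff (h.arcVertex_mem hab (by omega)) hy).1 hl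
  rcases arcVertex_inner_eq hk hk' hx (by omega) with
    ⟨rfl, rfl, rfl⟩ | ⟨rfl, rfl, rfl⟩
  · exact .inr rfl
  · left
    rw [← arcVertex_symm hab'.ne (by omega)]; congr 1; omega

end EdgeListed

/-! ### Folding the subdivision onto a binary tree -/

/-- The parent of a node of the binary tree. -/
def parentNode (x : Label) : Label := (x.1 / 2, x.1 / 2, x.2.2 + 1)

theorem foldl_relabel_map {P : List Label} {f : Label → Label} (hf : ∀ x ∈ P, f x ∉ P)
    (x : Label) : (P.map fun y => (y, f y)).foldl relabel x = if x ∈ P then f x else x := by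
  suffices h : ∀ Q : List Label, (∀ y ∈ Q, y ∈ P) → ∀ x,
      (Q.map fun y => (y, f y)).foldl relabel x = if x ∈ Q then f x else x from
    h P (fun _ h => h) x
  intro Q
  induction Q with
  | nil => simp
  | cons y Q ih =>
    intro hQ x
    rw [List.map_cons, List.foldl_cons, ih fun z hz => hQ z (by simp [hz])]
    by_cases hxy : x = y
    · have h1 : f y ∉ Q := fun h => hf y (hQ y (by simp)) (hQ _ (by simp [h]))
      simp [relabel, hxy, h1]
    · simp [relabel, hxy]

theorem foldNode_zero (L u : ℕ) : foldNode L (u, u, 0) = (u, u, 0) := by simp [foldNode]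

theorem foldNode_arcVertex {L a b k : ℕ} (hk : k ≤ L) :
    foldNode L (arcVertex L a b k) = (a / 2 ^ k, a / 2 ^ k, k) := by
  unfold arcVertex
  split_ifs with h1 h2 h3
  · simp [foldNode, h1]
  · omega
  · simp [foldNode, hk]
  · have h4 : 2 * L + 1 - (2 * L + 1 - k) = k := by omega
    simp [foldNode, show ¬ 2 * L + 1 - k ≤ L by omega, h4]

namespace EdgeListed

variable {g : SimpleGraph ℕ} {n L : ℕ} {E : List (ℕ × ℕ)}

theorem foldNode_link (h : EdgeListed g n L E) {x y : Label} (hx : x ∈ vertexList n L E)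
    (hy : y ∈ vertexList n L E) (hxy : linkAdj L x y = true) :
    foldNode L x = foldNode L y ∨ parentNode (foldNode L x) = foldNode L y ∨
      parentNode (foldNode L y) = foldNode L x := by
  obtain ⟨a, b, k, hab, hk, rfl, rfl⟩ := (h.linkAdj_iff hx hy).1 hxy
  have key : ∀ a b k, g.Adj a b → k + 1 ≤ L →
      parentNode (foldNode L (arcVertex L a b k)) = foldNode L (arcVertex L a b (k + 1)) := by
    intro a b k hab hk
    rw [foldNode_arcVertex (by omega), foldNode_arcVertex hk, parentNode,
      pow_succ, ← Nat.div_div_eq_div_mul]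
  rcases lt_trichotomy k L with hkL | rfl | hkL
  · exact .inr (.inl (key a b k hab hkL))
  · left
    have h1 := (h.lt hab).trans_le h.le_pow
    have h2 := (h.lt hab.symm).trans_le h.le_pow
    rw [← arcVertex_symm (k := k + 1) hab.ne (by omega), foldNode_arcVertex le_rfl,
      show 2 * k + 1 - (k + 1) = k by omega, foldNode_arcVertex le_rfl,
      Nat.div_eq_of_lt h1, Nat.div_eq_of_lt h2]
  · right; right
    have := key b a (2 * L - k) hab.symm (by omega)
    rw [← arcVertex_symm hab.ne (by omega), ← arcVertex_symm (k := k) hab.ne (by omega),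
      show 2 * L + 1 - k = 2 * L - k + 1 by omega, show 2 * L + 1 - (k + 1) = 2 * L - k by omega,
      this]

theorem exists_arc_of_mem_inner (h : EdgeListed g n L E) {x : Label} (hx : x ∈ innerList L E) :
    ∃ a b k, g.Adj a b ∧ 1 ≤ k ∧ k ≤ 2 * L ∧ x = arcVertex L a b k := by
  obtain ⟨u, v, k, he, hk, hk', rfl⟩ := mem_innerList.1 hx
  obtain ⟨hlt, hab⟩ := h.mem_iff.1 he
  exact ⟨u, v, k, hab, hk, hk', (arcVertex_of_lt hlt hk hk').symm⟩

/-- Each subdivision vertex lies on an arc on which it is at most as far from the start as from the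
end. -/
theorem exists_short_arc (h : EdgeListed g n L E) {x : Label} (hx : x ∈ innerList L E) :
    ∃ a b k, g.Adj a b ∧ 1 ≤ k ∧ k ≤ L ∧ x = arcVertex L a b k := by
  obtain ⟨a, b, k, hab, hk, hk', rfl⟩ := h.exists_arc_of_mem_inner hx
  by_cases hL : k ≤ L
  · exact ⟨a, b, k, hab, hk, hL, rfl⟩
  · exact ⟨b, a, 2 * L + 1 - k, hab.symm, by omega, by omega,
      (arcVertex_symm hab.ne (by omega)).symm⟩

theorem foldNode_mem_tree (h : EdgeListed g n L E) {x : Label} (hx : x ∈ vertexList n L E) :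
    ∃ j i, foldNode L x = (j, j, i) ∧ j < n ∧ i ≤ L ∧ j < 2 ^ (L - i) ∧
      (x ∈ innerList L E → 1 ≤ i) := by
  rcases mem_vertexList.1 hx with ⟨u, hu, rfl⟩ | hx
  · refine ⟨u, 0, foldNode_zero L u, hu, by omega, hu.trans_le h.le_pow, fun hx => ?_⟩
    exact absurd (h.fst_lt hx) (lt_irrefl _)
  · obtain ⟨a, b, k, hab, hk, hk', rfl⟩ := h.exists_short_arc hx
    refine ⟨a / 2 ^ k, k, foldNode_arcVertex hk', ?_, hk', ?_, fun _ => hk⟩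
    · exact (Nat.div_le_self _ _).trans_lt (h.lt hab)
    · rw [Nat.div_lt_iff_lt_mul (by positivity), ← pow_add, Nat.sub_add_cancel hk']
      exact (h.lt hab).trans_le h.le_pow

theorem foldNode_not_mem (h : EdgeListed g n L E) {x : Label} (hx : x ∈ vertexList n L E) :
    foldNode L x ∉ innerList L E := by
  obtain ⟨j, i, hj, -⟩ := h.foldNode_mem_tree hx
  rw [hj]
  exact fun hm => lt_irrefl _ (h.fst_lt hm)

theorem foldl_take_foldSteps (h : EdgeListed g n L E) (t : ℕ) (x : Label) :
    ((foldSteps L E).take t).foldl relabel x =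
      if x ∈ (innerList L E).take t then foldNode L x else x := by
  rw [foldSteps, ← List.map_take]
  refine foldl_relabel_map (fun y hy hm => ?_) x
  exact h.foldNode_not_mem (mem_vertexList.2 (.inr (List.mem_of_mem_take hy)))
    (List.mem_of_mem_take hm)

theorem foldl_foldSteps (h : EdgeListed g n L E) {x : Label} (hx : x ∈ vertexList n L E) :
    (foldSteps L E).foldl relabel x = foldNode L x := by
  have := h.foldl_take_foldSteps (foldSteps L E).length x
  rw [List.take_length, foldSteps, List.length_map, List.take_length] at this
  rw [foldSteps, this]
  rcases mem_vertexList.1 hx with ⟨u, hu, rfl⟩ | hx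
  · simp [foldNode_zero]
  · simp [hx]

end EdgeListed

theorem infix_range {k m : ℕ} (h : k + 1 < m) : [k, k + 1] <:+: List.range m := by
  obtain ⟨r, rfl⟩ := Nat.exists_eq_add_of_le h
  refine ⟨List.range k, (List.range r).map (k + 1 + 1 + ·), ?_⟩
  rw [List.range_add, List.range_succ, List.range_succ]
  simp

/-- Consecutive subdivision vertices of an edge are consecutive in the list of all of them. -/
theorem infix_innerList {L : ℕ} {E : List (ℕ × ℕ)} {u v k : ℕ} (he : (u, v) ∈ E)
    (hk : 1 ≤ k) (hk' : k + 1 ≤ 2 * L) :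
    [(u, v, k), (u, v, k + 1)] <:+: innerList L E := by
  obtain ⟨E₁, E₂, rfl⟩ := List.append_of_mem he
  have h1 := infix_range (k := k - 1) (m := 2 * L) (by omega)
  have h2 := h1.map fun k => ((u, v, k + 1) : Label)
  simp only [List.map_cons, List.map_nil, Nat.sub_add_cancel hk] at h2
  refine h2.trans ⟨innerList L E₁, innerList L E₂, ?_⟩
  simp [innerList]

theorem eq_getElem_of_infix {α : Type*} {l : List α} (hl : l.Nodup) {x y : α} (h : [x, y] <:+: l)
    {t : ℕ} (hx : x ∈ l.take t) (hy : y ∉ l.take t) : l[t]? = some y := by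
  obtain ⟨A, B, rfl⟩ := h
  rcases lt_trichotomy t (A.length + 1) with ht | rfl | ht
  · have h1 : x ∈ A := by
      rw [List.append_assoc, List.take_append_of_le_length (by omega)] at hx
      exact List.mem_of_mem_take hx
    rw [List.append_assoc] at hl
    exact absurd rfl ((List.nodup_append.1 hl).2.2 x h1 x (by simp))
  · simp
  · refine absurd ?_ hy
    have h1 : A ++ [x, y] <+: List.take t (A ++ [x, y] ++ B) :=
      List.prefix_take_iff.2 ⟨List.prefix_append _ _, by simp; omega⟩
    exact h1.subset (by simp)

theorem not_mem_take_of_infix {α : Type*} {l : List α} (hl : l.Nodup) {x y : α}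
    (h : [x, y] <:+: l) {t : ℕ} (hx : y ∈ l.take t) : x ∈ l.take t := by
  obtain ⟨A, B, rfl⟩ := h
  rcases le_or_gt t (A.length + 1) with ht | ht
  · have h1 : y ∈ A ++ [x] := by
      rw [show A ++ [x, y] ++ B = (A ++ [x]) ++ (y :: B) by simp,
        List.take_append_of_le_length (by simpa using ht)] at hx
      exact List.mem_of_mem_take hx
    rw [show A ++ [x, y] ++ B = (A ++ [x]) ++ (y :: B) by simp] at hl
    exact absurd rfl ((List.nodup_append.1 hl).2.2 y h1 y (by simp))
  · have h1 : A ++ [x, y] <+: List.take t (A ++ [x, y] ++ B) :=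
      List.prefix_take_iff.2 ⟨List.prefix_append _ _, by simp; omega⟩
    exact h1.subset (by simp)

namespace EdgeListed

variable {g : SimpleGraph ℕ} {n L : ℕ} {E : List (ℕ × ℕ)}

/-- While the subdivision vertices are folded one by one, at most one vertex that is not folded yet
has a folded neighbour: the next one. -/
theorem eq_next_of_link (h : EdgeListed g n L E) {x y : Label} {t : ℕ}
    (hx : x ∈ (innerList L E).take t) (hy : y ∈ innerList L E) (hy' : y ∉ (innerList L E).take t)
    (hxy : linkAdj L x y = true) : (innerList L E)[t]? = some y := by
  have hxi := List.mem_of_mem_take hx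
  have hlx := h.fst_lt hxi
  have hly := h.fst_lt hy
  rw [linkAdj, Bool.or_eq_true, linkTest_iff, linkTest_iff] at hxy
  obtain ⟨u, v, k, he, hk, hk', rfl⟩ := mem_innerList.1 hxi
  obtain ⟨u', v', k', he', hk1, hk1', rfl⟩ := mem_innerList.1 hy
  dsimp only at *
  rcases hxy with (⟨-, rfl, rfl, rfl⟩ | ⟨hc, -⟩) | (⟨-, rfl, rfl, rfl⟩ | ⟨hc, -⟩)
  · exact eq_getElem_of_infix h.nodup_innerList (infix_innerList he hk hk1') hx hy'
  · omega
  · exact absurd (not_mem_take_of_infix h.nodup_innerList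
      (infix_innerList he hk1 hk') hx) hy'
  · omega

end EdgeListed

/-! ### Contracting the binary tree -/

/-- A labelling of the vertices of the subdivision by tree nodes, as it occurs while the tree is
contracted by the replacements `T` of labels: adjacent vertices lie in the same node or in a node and
its parent, and the nodes that have been replaced do not occur any more. -/
structure IsTreeLabelling (n L : ℕ) (D : List Label) (T : List (Label × Label))
    (f : Label → Label) : Prop where
  node : ∀ x ∈ D, ∃ j i, f x = (j, j, i) ∧ j < n ∧ i ≤ L ∧ j < 2 ^ (L - i)
  link : ∀ x ∈ D, ∀ y ∈ D, linkAdj L x y = true →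
    f x = f y ∨ parentNode (f x) = f y ∨ parentNode (f y) = f x
  gone : ∀ p ∈ T, ∀ x ∈ D, f x ≠ p.1

theorem mem_treeSteps {n L : ℕ} {p : Label × Label} : p ∈ treeSteps n L ↔
    ∃ i < L, ∃ j < n, p = ((j, j, i), (j / 2, j / 2, i + 1)) := by
  simp [treeSteps, eq_comm]

theorem pairwise_treeSteps (n L : ℕ) :
    (treeSteps n L).Pairwise fun p q => p.1.2.2 ≤ q.1.2.2 := by
  refine List.pairwise_flatMap.2 ⟨fun i _ => ?_, ?_⟩
  · rw [List.pairwise_map]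
    exact List.pairwise_of_forall fun _ _ => le_rfl
  · refine List.pairwise_lt_range.imp fun {i i'} hi => ?_
    intro p hp q hq
    simp only [List.mem_map] at hp hq
    obtain ⟨_, _, rfl⟩ := hp
    obtain ⟨_, _, rfl⟩ := hq
    exact hi.le

theorem List.Pairwise.rel_take_getElem {α : Type*} {R : α → α → Prop} {l : List α}
    (h : l.Pairwise R) {t : ℕ} (ht : t < l.length) {a : α} (ha : a ∈ l.take t) : R a l[t] := by
  rw [← List.take_append_drop t l, List.pairwise_append] at h
  exact h.2.2 a ha _ (List.mem_drop_iff_getElem.2 ⟨0, by omega, by simp⟩)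

theorem List.Pairwise.mem_take_or_rel {α : Type*} {R : α → α → Prop} (hR : ∀ a, R a a) {l : List α}
    (h : l.Pairwise R) {t : ℕ} (ht : t < l.length) {a : α} (ha : a ∈ l) :
    a ∈ l.take t ∨ R l[t] a := by
  rw [← List.take_append_drop t l, List.mem_append] at ha
  rcases ha with ha | ha
  · exact .inl ha
  · right
    rw [← List.take_append_drop t l, List.pairwise_append] at h
    have h2 := h.2.1
    rw [List.drop_eq_getElem_cons ht] at h2 ha
    rcases List.mem_cons.1 ha with rfl | ha
    · exact hR _
    · exact (List.pairwise_cons.1 h2).1 _ ha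

/-- Since the levels are processed in order, a node has lost its children when it is merged into its
parent, so that the labelled tree keeps its structure. -/
theorem isTreeLabelling_take {n L : ℕ} {D : List Label} {f : Label → Label}
    (hf : IsTreeLabelling n L D [] f) {t : ℕ} (ht : t ≤ (treeSteps n L).length) :
    IsTreeLabelling n L D ((treeSteps n L).take t)
      fun x => ((treeSteps n L).take t).foldl relabel (f x) := by
  induction t with
  | zero => simpa using hf
  | succ t ih =>
    have ht' : t < (treeSteps n L).length := by omega
    obtain ⟨hnode, hlink, hgone⟩ := ih (by omega)
    have hp : (treeSteps n L)[t] ∈ treeSteps n L := List.getElem_mem ht'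
    have htake : ∀ q ∈ (treeSteps n L).take t, q.1.2.2 ≤ (treeSteps n L)[t].1.2.2 :=
      fun q hq => (pairwise_treeSteps n L).rel_take_getElem ht' hq
    have htake' : ∀ q ∈ treeSteps n L, q.1.2.2 < (treeSteps n L)[t].1.2.2 →
        q ∈ (treeSteps n L).take t := fun q hq hlt =>
      ((pairwise_treeSteps n L).mem_take_or_rel (R := fun p q => p.1.2.2 ≤ q.1.2.2)
        (fun _ => le_rfl) ht' hq).resolve_right (by omega)
    have hget := List.getElem?_eq_getElem ht'
    simp only [foldl_take_succ ht']
    set f' := fun x => ((treeSteps n L).take t).foldl relabel (f x) with hf'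
    generalize (treeSteps n L)[t] = p at *
    obtain ⟨i, hi, j, hj, rfl⟩ := mem_treeSteps.1 hp
    dsimp only at *
    -- the children of the current node have been replaced before
    have hchild : ∀ x ∈ D, parentNode (f' x) ≠ (j, j, i) := by
      intro x hx hpar
      obtain ⟨j', i', hxj, hj', -, -⟩ := hnode x hx
      rw [show f' x = _ from hxj, parentNode] at hpar
      simp only [Prod.mk.injEq] at hpar
      refine hgone ((j', j', i'), (j' / 2, j' / 2, i' + 1)) (htake' _
        (mem_treeSteps.2 ⟨i', by omega, j', hj', rfl⟩) ?_) x hx hxj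
      simp only; omega
    refine ⟨?_, ?_, ?_⟩
    · intro x hx
      obtain ⟨j', i', hxj, hj', hi', hlt⟩ := hnode x hx
      change ∃ j_1 i_1, relabel (f' x) _ = _ ∧ _
      by_cases hc : f' x = (j, j, i)
      · refine ⟨j / 2, i + 1, by simp [relabel, hc], by omega, by omega, ?_⟩
        have h1 : (j', j', i') = (j, j, i) := hxj.symm.trans hc
        simp only [Prod.mk.injEq] at h1
        obtain ⟨rfl, -, rfl⟩ := h1
        rw [Nat.div_lt_iff_lt_mul two_pos, ← pow_succ, show L - (i' + 1) + 1 = L - i' by omega]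
        exact hlt
      · exact ⟨j', i', by simp only [relabel, hc, if_false]; exact hxj, hj', hi', hlt⟩
    · intro x hx y hy hxy
      have h1 := hlink x hx y hy hxy
      have h2 := hchild x hx
      have h3 := hchild y hy
      change relabel (f' x) _ = relabel (f' y) _ ∨ parentNode (relabel (f' x) _) = relabel (f' y) _ ∨
        parentNode (relabel (f' y) _) = relabel (f' x) _
      change f' x = f' y ∨ parentNode (f' x) = f' y ∨ parentNode (f' y) = f' x at h1
      by_cases hcx : f' x = (j, j, i) <;> by_cases hcy : f' y = (j, j, i)
      · left; rw [hcx, hcy]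
      · rw [hcx] at h1
        rcases h1 with h1 | h1 | h1
        · exact absurd h1.symm hcy
        · left
          rw [hcx, ← h1]
          simp [relabel, parentNode]
        · exact absurd h1 h3
      · rw [hcy] at h1
        rcases h1 with h1 | h1 | h1
        · exact absurd h1 hcx
        · exact absurd h1 h2
        · left
          rw [hcy, ← h1]
          simp [relabel, parentNode]
      · simpa only [relabel, hcx, hcy, if_false] using h1
    · intro q hq x hx
      have hxq : relabel (f' x) ((j, j, i), (j / 2, j / 2, i + 1)) ≠ (j, j, i) := by
        unfold relabel
        split_ifs with hc
        · simp
        · exact hc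
      rw [List.take_add_one, List.mem_append] at hq
      rcases hq with hq | hq
      · change relabel (f' x) _ ≠ q.1
        unfold relabel
        split_ifs with hc
        · have h1 := htake q hq
          intro h
          rw [← h] at h1
          simp at h1
        · exact hgone q hq x hx
      · rw [hget, Option.toList_some, List.mem_singleton] at hq
        rw [hq]
        exact hxq

namespace EdgeListed

variable {g : SimpleGraph ℕ} {n L : ℕ} {E : List (ℕ × ℕ)}

theorem isTreeLabelling_foldNode (h : EdgeListed g n L E) :
    IsTreeLabelling n L (vertexList n L E) [] (foldNode L) where
  node x hx := by
    obtain ⟨j, i, h1, h2, h3, h4, -⟩ := h.foldNode_mem_tree hx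
    exact ⟨j, i, h1, h2, h3, h4⟩
  link x hx y hy hxy := h.foldNode_link hx hy hxy
  gone := by simp

theorem foldl_steps_eq_root (h : EdgeListed g n L E) {x : Label} (hx : x ∈ vertexList n L E) :
    (foldSteps L E ++ treeSteps n L).foldl relabel x = (0, 0, L) := by
  rw [List.foldl_append, h.foldl_foldSteps hx]
  obtain ⟨hnode, -, hgone⟩ := isTreeLabelling_take h.isTreeLabelling_foldNode le_rfl
  simp only [List.take_length] at *
  obtain ⟨j, i, h1, hj, hi, hlt⟩ := hnode x hx
  rw [h1]
  rcases hi.eq_or_lt with rfl | hi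
  · simp at hlt
    simp [hlt]
  · exact absurd h1 (hgone _ (mem_treeSteps.2 ⟨i, hi, j, hj, rfl⟩) x hx)

end EdgeListed

/-- The labels of the parent and of the two children of a tree node. -/
def nodeNeighbors (c : Label) : Finset Label :=
  {parentNode c, (2 * c.1, 2 * c.1, c.2.2 - 1), (2 * c.1 + 1, 2 * c.1 + 1, c.2.2 - 1)}

theorem card_nodeNeighbors_le (c : Label) : (nodeNeighbors c).card ≤ 3 := Finset.card_le_three

theorem mem_nodeNeighbors_of_parent {c : Label} {j i : ℕ} (hc : parentNode (j, j, i) = c) :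
    (j, j, i) ∈ nodeNeighbors c := by
  subst hc
  simp only [nodeNeighbors, parentNode, Finset.mem_insert, Finset.mem_singleton, Prod.mk.injEq]
  omega

namespace EdgeListed

variable {g : SimpleGraph ℕ} {n L : ℕ} {E : List (ℕ × ℕ)}

/-- Along the whole sequence of labellings, each class has at most four red neighbours. While the
subdivision is folded, these are the parent and the two children of a tree node and the vertex that
is folded next; while the tree is contracted, the parent and the two children. -/
theorem red_neighbors (h : EdgeListed g n L E) {t : ℕ}
    (ht : t ≤ (foldSteps L E ++ treeSteps n L).length) {lab : Label → Label}
    (hlab : lab = fun x => ((foldSteps L E ++ treeSteps n L).take t).foldl relabel x)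
    {v : Label} (hv : v ∈ vertexList n L E) : ∃ F : Finset Label, F.card ≤ 4 ∧
      ∀ x ∈ vertexList n L E, ∀ y ∈ vertexList n L E, ∀ x' ∈ vertexList n L E,
      ∀ y' ∈ vertexList n L E, lab x = lab v → lab x' = lab v → lab y ≠ lab v → lab y' = lab y →
        linkAdj L x y = true → linkAdj L x' y' ≠ true → lab y ∈ F := by
  rcases le_total t (foldSteps L E).length with ht' | ht'
  · have hlab' : ∀ x, lab x = if x ∈ (innerList L E).take t then foldNode L x else x := by
      intro x
      rw [hlab]
      dsimp only
      rw [List.take_append_of_le_length ht', h.foldl_take_foldSteps]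
    set P := (innerList L E).take t with hP
    have hPI : ∀ {x}, x ∈ P → x ∈ innerList L E := fun hx => List.mem_of_mem_take hx
    -- a label of an unfolded subdivision vertex belongs to this vertex only
    have huniq : ∀ x ∈ vertexList n L E, ∀ y ∈ innerList L E, y ∉ P → lab x = lab y → x = y := by
      intro x hx y hy hyP hxy
      rw [hlab' y, if_neg hyP, hlab'] at hxy
      split_ifs at hxy with hxP
      · exact absurd (hxy ▸ hy) (h.foldNode_not_mem hx)
      · exact hxy
    have hfold : ∀ x, (x ∈ innerList L E → x ∈ P) → x ∈ vertexList n L E →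
        lab x = foldNode L x := by
      intro x hx hxD
      rw [hlab']
      split_ifs with hxP
      · rfl
      · rcases mem_vertexList.1 hxD with ⟨u, hu, rfl⟩ | hxI
        · rw [foldNode_zero]
        · exact absurd (hx hxI) hxP
    by_cases hvP : v ∈ innerList L E ∧ v ∉ P
    · obtain ⟨a, b, k, hab, hk, hk', hvk⟩ := h.exists_arc_of_mem_inner hvP.1
      refine ⟨{lab (arcVertex L a b (k - 1)), lab (arcVertex L a b (k + 1))},
        Finset.card_le_two.trans (by norm_num), ?_⟩
      intro x hx y hy x' hx' y' hy' hxv hxv' hyv hyy hl hl'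
      obtain rfl := huniq x hx v hvP.1 hvP.2 hxv
      rw [hvk] at hl
      rcases h.eq_of_linkAdj_inner hab hk hk' hy hl with rfl | rfl <;> simp
    · have hvf := hfold v (by tauto) hv
      refine ⟨insert ((innerList L E).getD t v) (nodeNeighbors (lab v)),
        (Finset.card_insert_le _ _).trans (by have := card_nodeNeighbors_le (lab v); omega), ?_⟩
      intro x hx y hy x' hx' y' hy' hxv hxv' hyv hyy hl hl'
      have hxP : x ∈ innerList L E → x ∈ P := by
        intro hxI
        by_contra hxP
        obtain rfl := huniq v hv x hxI hxP hxv.symm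
        exact hvP ⟨hxI, hxP⟩
      have hxf := hfold x hxP hx
      by_cases hyP : y ∈ innerList L E ∧ y ∉ P
      · obtain rfl := huniq y' hy' y hyP.1 hyP.2 hyy
        rcases mem_vertexList.1 hx with ⟨u, hu, rfl⟩ | hxI
        · -- a vertex of the original graph is alone in its class
          have hx'P : x' ∈ innerList L E → x' ∈ P := by
            intro hxI
            by_contra hxP
            obtain rfl := huniq v hv x' hxI hxP hxv'.symm
            exact hvP ⟨hxI, hxP⟩
          have h1 := hxv.trans hxv'.symm
          rw [hxf, hfold x' hx'P hx', foldNode_zero] at h1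
          rcases mem_vertexList.1 hx' with ⟨u', hu', rfl⟩ | hxI'
          · rw [foldNode_zero] at h1
            rw [h1] at hl
            exact absurd hl hl'
          · obtain ⟨j, i, h2, -, -, -, h3⟩ := h.foldNode_mem_tree hx'
            rw [h2] at h1
            have := h3 hxI'
            simp only [Prod.mk.injEq] at h1
            omega
        · have h1 := h.eq_next_of_link (hxP hxI) hyP.1 hyP.2 hl
          rw [hlab' y', if_neg hyP.2, List.getD_eq_getElem?_getD, h1]
          simp
      · have hyf := hfold y (by tauto) hy
        obtain ⟨j, i, h2, -⟩ := h.foldNode_mem_tree hy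
        refine Finset.mem_insert_of_mem ?_
        rw [← hxv] at hyv ⊢
        rw [hxf, hyf] at hyv ⊢
        rcases h.foldNode_link hx hy hl with h1 | h1 | h1
        · exact absurd h1.symm hyv
        · simp [nodeNeighbors, h1]
        · rw [h2] at h1 ⊢
          exact mem_nodeNeighbors_of_parent h1
  · obtain ⟨s, rfl⟩ := Nat.exists_eq_add_of_le ht'
    have hs : s ≤ (treeSteps n L).length := by rw [List.length_append] at ht; omega
    obtain ⟨hnode, hlink, -⟩ := isTreeLabelling_take h.isTreeLabelling_foldNode hs
    have hlab' : ∀ x ∈ vertexList n L E,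
        lab x = ((treeSteps n L).take s).foldl relabel (foldNode L x) := by
      intro x hx
      rw [hlab, ← h.foldl_foldSteps hx, ← List.foldl_append]
      dsimp only
      rw [List.take_length_add_append]
    refine ⟨nodeNeighbors (lab v), (card_nodeNeighbors_le _).trans (by norm_num), ?_⟩
    intro x hx y hy x' hx' y' hy' hxv hxv' hyv hyy hl hl'
    obtain ⟨j, i, h2, -⟩ := hnode y hy
    have h3 := hlink x hx y hy hl
    rw [← hlab' y hy] at h2 h3
    rw [← hlab' x hx] at h3
    rw [← hxv] at hyv ⊢
    rcases h3 with h1 | h1 | h1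
    · exact absurd h1.symm hyv
    · simp [nodeNeighbors, h1]
    · rw [h2] at h1 ⊢
      exact mem_nodeNeighbors_of_parent h1

end EdgeListed

/-- The subdivision as a graph on `{0, …, N - 1}`. -/
def subdivision (L : ℕ) (D : List Label) : SimpleGraph (Fin D.length) where
  Adj i j := linkAdj L (D.get i) (D.get j) = true
  symm := ⟨fun i j h => by rwa [linkAdj_comm]⟩
  loopless := ⟨fun i h => by
    rw [linkAdj, Bool.or_self, linkTest_iff] at h
    omega⟩

theorem EdgeListed.isTwinSequence_subdivision {g : SimpleGraph ℕ} {n L : ℕ} {E : List (ℕ × ℕ)}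
    (h : EdgeListed g n L E) :
    IsTwinSequence (subdivision L (vertexList n L E)) 4
      (mergeSeq (vertexList n L E) (foldSteps L E ++ treeSteps n L)
        (foldSteps L E ++ treeSteps n L).length) := by
  refine isTwinSequence_mergeSeq h.nodup_vertexList (c := (0, 0, L))
    (fun x hx => h.foldl_steps_eq_root hx) fun t ht v => ?_
  obtain ⟨F, hF, hF'⟩ := h.red_neighbors ht rfl (List.get_mem (vertexList n L E) v)
  exact ⟨F, hF, fun x y x' y' h1 h2 h3 h4 h5 h6 => hF' _ (List.get_mem _ _) _ (List.get_mem _ _) _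
    (List.get_mem _ _) _ (List.get_mem _ _) h1 h2 h3 h4 h5 h6⟩

/-! ### Paths of the subdivision and of the original graph -/

/-- The vertices of the original graph on a list of vertices of the subdivision. -/
def branches (Q : List Label) : List ℕ := (Q.filter fun x => decide (x.2.2 = 0)).map Prod.fst

/-- The path of the subdivision that belongs to a path of the original graph. -/
def expand (L : ℕ) : List ℕ → List Label
  | [] => []
  | [a] => [(a, a, 0)]
  | a :: b :: l => (List.range (2 * L + 1)).map (arcVertex L a b) ++ expand L (b :: l)

theorem branches_cons (x : Label) (Q : List Label) :
    branches (x :: Q) = if x.2.2 = 0 then x.1 :: branches Q else branches Q := by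
  unfold branches
  by_cases h : x.2.2 = 0 <;> simp [h]

theorem arcVertex_ne_zero {L a b k : ℕ} (hk : 1 ≤ k) (hk' : k ≤ 2 * L) :
    (arcVertex L a b k).2.2 ≠ 0 := by
  unfold arcVertex
  split_ifs <;> dsimp only <;> omega

theorem arcVertex_inner_ne {L a b k : ℕ} (hk : 1 ≤ k) (hk' : k ≤ 2 * L) :
    arcVertex L a b (k - 1) ≠ arcVertex L a b (k + 1) := by
  unfold arcVertex
  split_ifs <;> intro he <;> simp only [Prod.mk.injEq] at he <;> omega

theorem eq_zero_of_arcVertex_eq {L a a' b k : ℕ} (h : arcVertex L a' b k = (a, a, 0))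
    (hk : k ≤ 2 * L) : k = 0 ∧ a' = a := by
  by_cases h0 : k = 0
  · subst h0
    simp [arcVertex] at h
    exact ⟨rfl, h⟩
  · exact absurd (by rw [h]) (arcVertex_ne_zero (a := a') (b := b) (by omega : 1 ≤ k) hk)

namespace EdgeListed

variable {g : SimpleGraph ℕ} {n L : ℕ} {E : List (ℕ × ℕ)}

/-- A path of the subdivision, followed from an original vertex or from a subdivision vertex on the
way from `a` to `b`: it never turns round inside of an edge, so that between two original vertices
there is a whole subdivided edge. -/
theorem length_le_of_path (h : EdgeListed g n L E) (Q : List Label) :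
    (∀ a, ((a, a, 0) :: Q).IsChain (fun x y => linkAdj L x y = true) → ((a, a, 0) :: Q).Nodup →
      (∀ y ∈ (a, a, 0) :: Q, y ∈ vertexList n L E) →
      Q.length ≤ (2 * L + 1) * (branches Q).length + 2 * L ∧
        (a :: branches Q).IsChain g.Adj) ∧
    (∀ a b k, g.Adj a b → 1 ≤ k → k ≤ 2 * L →
      (arcVertex L a b k :: Q).IsChain (fun x y => linkAdj L x y = true) →
      (arcVertex L a b k :: Q).Nodup →
      (∀ y ∈ arcVertex L a b k :: Q, y ∈ vertexList n L E) →
      (∀ y ∈ Q.head?, y ≠ arcVertex L a b (k - 1)) →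
      Q.length + k ≤ (2 * L + 1) * (branches Q).length + 2 * L ∧
        (branches Q).IsChain g.Adj ∧ ∀ c ∈ (branches Q).head?, c = b) := by
  induction Q with
  | nil =>
    simp only [branches, List.filter_nil, List.map_nil, List.length_nil]
    exact ⟨fun _ _ _ _ => ⟨by omega, by simp⟩, fun _ _ _ _ _ _ _ _ _ _ => ⟨by omega, by simp, by simp⟩⟩
  | cons y Q ih =>
    have hhead : ∀ x : Label, (x :: y :: Q).Nodup → ∀ z ∈ Q.head?, z ≠ x := by
      rintro x hx z hz rfl
      have := List.mem_of_mem_head? hz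
      simp [this] at hx
    constructor
    · intro a hc hn hm
      have hm' : ∀ z ∈ y :: Q, z ∈ vertexList n L E := fun z hz => hm z (List.mem_cons_of_mem _ hz)
      obtain ⟨hl, hc'⟩ := List.isChain_cons_cons.1 hc
      obtain ⟨a', b, k, hab, hk, hx, rfl⟩ :=
        (h.linkAdj_iff (hm _ List.mem_cons_self) (hm' _ List.mem_cons_self)).1 hl
      obtain ⟨rfl, rfl⟩ := eq_zero_of_arcVertex_eq hx.symm hk
      have hL := h.one_le hab
      obtain ⟨h1, h2, h3⟩ := ih.2 a' b 1 hab le_rfl (by omega) hc' hn.of_cons hm'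
        (hhead _ hn)
      have hne := arcVertex_ne_zero (L := L) (a := a') (b := b) le_rfl (by omega)
      rw [branches_cons, if_neg hne]
      refine ⟨h1, List.isChain_cons.2 ⟨fun c hc => ?_, h2⟩⟩
      rw [h3 c hc]
      exact hab
    · intro a b k hab hk hk' hc hn hm hh
      have hm' : ∀ z ∈ y :: Q, z ∈ vertexList n L E := fun z hz => hm z (List.mem_cons_of_mem _ hz)
      obtain ⟨hl, hc'⟩ := List.isChain_cons_cons.1 hc
      rcases h.eq_of_linkAdj_inner hab hk hk' (hm' _ List.mem_cons_self) hl with rfl | rfl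
      · exact absurd rfl (hh _ rfl)
      · rcases hk'.lt_or_eq with hk' | rfl
        · obtain ⟨h1, h2, h3⟩ := ih.2 a b (k + 1) hab (by omega) hk' hc' hn.of_cons hm'
            (hhead _ hn)
          have hne := arcVertex_ne_zero (L := L) (a := a) (b := b) (k := k + 1) (by omega) hk'
          rw [branches_cons, if_neg hne, List.length_cons]
          exact ⟨by omega, h2, h3⟩
        · rw [arcVertex_last] at *
          obtain ⟨h1, h2⟩ := ih.1 b hc' hn.of_cons hm'
          rw [branches_cons, if_pos rfl]
          refine ⟨?_, h2, by simp⟩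
          simp only [List.length_cons, mul_add]
          omega

theorem branches_of_path (h : EdgeListed g n L E) {Q : List Label}
    (hc : Q.IsChain fun x y => linkAdj L x y = true) (hn : Q.Nodup)
    (hm : ∀ y ∈ Q, y ∈ vertexList n L E) :
    Q.length + 1 ≤ (2 * L + 1) * ((branches Q).length + 1) ∧ (branches Q).IsChain g.Adj ∧
      (branches Q).Nodup := by
  have hnodup : (branches Q).Nodup := by
    refine (hn.filter _).map_on fun x hx y hy hxy => ?_
    rw [List.mem_filter, decide_eq_true_eq] at hx hy
    have key : ∀ x ∈ Q, x.2.2 = 0 → x = (x.1, x.1, 0) := by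
      intro x hx h0
      rcases mem_vertexList.1 (hm x hx) with ⟨u, -, rfl⟩ | hx
      · rfl
      · obtain ⟨u, v, k, -, hk, -, rfl⟩ := mem_innerList.1 hx
        simp at h0; omega
    rw [key x hx.1 hx.2, key y hy.1 hy.2, hxy]
  suffices hs : Q.length + 1 ≤ (2 * L + 1) * ((branches Q).length + 1) ∧
      (branches Q).IsChain g.Adj from ⟨hs.1, hs.2, hnodup⟩
  rcases Q with _ | ⟨x, Q⟩
  · simp [branches]
  rcases mem_vertexList.1 (hm x List.mem_cons_self) with ⟨u, hu, rfl⟩ | hx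
  · obtain ⟨h1, h2⟩ := (h.length_le_of_path Q).1 u hc hn hm
    rw [branches_cons, if_pos rfl]
    refine ⟨?_, h2⟩
    simp only [List.length_cons, mul_add]
    omega
  · -- the path follows an arc through `x` in the direction that does not lead back
    have harc : ∃ a b k, g.Adj a b ∧ 1 ≤ k ∧ k ≤ 2 * L ∧ x = arcVertex L a b k ∧
        ∀ y ∈ Q.head?, y ≠ arcVertex L a b (k - 1) := by
      obtain ⟨a, b, k, hab, hk, hk', rfl⟩ := h.exists_arc_of_mem_inner hx
      by_cases hb : ∀ y ∈ Q.head?, y ≠ arcVertex L a b (k - 1)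
      · exact ⟨a, b, k, hab, hk, hk', rfl, hb⟩
      · push Not at hb
        obtain ⟨y, hy, rfl⟩ := hb
        refine ⟨b, a, 2 * L + 1 - k, hab.symm, by omega, by omega,
          (arcVertex_symm hab.ne (by omega)).symm, fun z hz => ?_⟩
        rw [Option.mem_def.1 hy, Option.mem_some_iff] at hz
        rw [← hz, show 2 * L + 1 - k - 1 = 2 * L + 1 - (k + 1) by omega,
          arcVertex_symm hab.ne (by omega)]
        exact arcVertex_inner_ne hk hk'
    obtain ⟨a, b, k, hab, hk, hk', rfl, hh⟩ := harc
    obtain ⟨h1, h2, -⟩ := (h.length_le_of_path Q).2 a b k hab hk hk' hc hn hm hh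
    rw [branches_cons, if_neg (arcVertex_ne_zero hk hk')]
    refine ⟨?_, h2⟩
    simp only [List.length_cons, mul_add]
    omega

end EdgeListed

theorem expand_cons_eq (L a : ℕ) (l : List ℕ) : ∃ Q, expand L (a :: l) = (a, a, 0) :: Q := by
  cases l with
  | nil => exact ⟨[], rfl⟩
  | cons b l =>
    rw [expand, List.range_succ_eq_map, List.map_cons, List.cons_append, arcVertex_zero]
    exact ⟨_, rfl⟩

theorem length_expand (L a : ℕ) (l : List ℕ) :
    (expand L (a :: l)).length = (2 * L + 1) * l.length + 1 := by
  induction l generalizing a with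
  | nil => simp [expand]
  | cons b l ih =>
    simp only [expand, List.length_append, List.length_map, List.length_range, ih, List.length_cons]
    ring

theorem mem_expand {L : ℕ} {l : List ℕ} {x : Label} (hx : x ∈ expand L l) :
    (∃ a ∈ l, x = (a, a, 0)) ∨
      ∃ a b k, [a, b] <:+: l ∧ 1 ≤ k ∧ k ≤ 2 * L ∧ x = arcVertex L a b k := by
  induction l using expand.induct with
  | case1 => simp [expand] at hx
  | case2 a => simp [expand] at hx; simp [hx]
  | case3 a b l ih =>
    rw [expand, List.mem_append, List.mem_map] at hx
    rcases hx with ⟨k, hk, rfl⟩ | hx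
    · rw [List.mem_range] at hk
      rcases Nat.eq_zero_or_pos k with rfl | hk0
      · exact .inl ⟨a, by simp, rfl⟩
      · exact .inr ⟨a, b, k, ⟨[], l, by simp⟩, hk0, by omega, rfl⟩
    · rcases ih hx with ⟨c, hc, rfl⟩ | ⟨a', b', k, hi, hk⟩
      · exact .inl ⟨c, List.mem_cons_of_mem _ hc, rfl⟩
      · exact .inr ⟨a', b', k, List.infix_cons hi, hk⟩

theorem infix_expand {L a b k : ℕ} {l : List ℕ} (h : [a, b] <:+: l) (hk : k ≤ 2 * L) :
    [arcVertex L a b k, arcVertex L a b (k + 1)] <:+: expand L l := by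
  induction l using expand.induct with
  | case1 => simp at h
  | case2 c => have := h.length_le; simp at this
  | case3 c d l ih =>
    rcases List.infix_cons_iff.1 h with h | h
    · obtain ⟨t, ht⟩ := h
      simp only [List.cons_append, List.nil_append, List.cons.injEq] at ht
      obtain ⟨rfl, rfl, rfl⟩ := ht
      obtain ⟨Q, hQ⟩ := expand_cons_eq L b t
      rw [expand, hQ, ← arcVertex_last L a b]
      have h1 := (infix_range (k := k) (m := 2 * L + 2) (by omega)).map (arcVertex L a b)
      refine h1.trans ⟨[], Q, ?_⟩
      rw [List.range_succ]
      simp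
    · exact (ih h).trans (List.suffix_append _ _).isInfix

namespace EdgeListed

variable {g : SimpleGraph ℕ} {n L : ℕ} {E : List (ℕ × ℕ)}

theorem adj_of_infix {l : List ℕ} (hl : l.IsChain g.Adj) {a b : ℕ} (h : [a, b] <:+: l) :
    g.Adj a b := by
  have := hl.infix h
  simpa using this

theorem expand_subset (h : EdgeListed g n L E) {l : List ℕ} (hl : l.IsChain g.Adj)
    (hn : ∀ a ∈ l, a < n) {x : Label} (hx : x ∈ expand L l) : x ∈ vertexList n L E := by
  rcases mem_expand hx with ⟨a, ha, rfl⟩ | ⟨a, b, k, hi, hk, hk', rfl⟩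
  · exact mem_vertexList.2 (.inl ⟨a, hn a ha, rfl⟩)
  · exact h.arcVertex_mem (adj_of_infix hl hi) (by omega)

theorem isChain_expand (h : EdgeListed g n L E) {l : List ℕ} (hl : l.IsChain g.Adj) :
    (expand L l).IsChain fun x y => linkAdj L x y = true := by
  induction l using expand.induct with
  | case1 => simp [expand]
  | case2 a => simp [expand]
  | case3 a b l ih =>
    obtain ⟨hab, hl'⟩ := List.isChain_cons_cons.1 hl
    rw [expand]
    refine List.isChain_append.2 ⟨?_, ih hl', ?_⟩
    · rw [List.isChain_map, List.isChain_range]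
      exact fun k hk => h.linkAdj_arcVertex hab (by omega)
    · obtain ⟨Q, hQ⟩ := expand_cons_eq L b l
      rw [hQ, List.range_succ]
      simp only [List.map_append, List.map_cons, List.map_nil, List.getLast?_append,
        List.getLast?_singleton, Option.some_or, Option.mem_some_iff, List.head?_cons,
        forall_eq']
      rw [← arcVertex_last L a b]
      exact h.linkAdj_arcVertex hab le_rfl

theorem nodup_expand (L : ℕ) {l : List ℕ} (hl : l.IsChain g.Adj) (hn : l.Nodup) :
    (expand L l).Nodup := by
  induction l using expand.induct with
  | case1 => simp [expand]
  | case2 a => simp [expand]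
  | case3 a b l ih =>
    obtain ⟨hab, hl'⟩ := List.isChain_cons_cons.1 hl
    obtain ⟨ha, hn'⟩ := List.nodup_cons.1 hn
    rw [expand]
    refine List.nodup_append.2 ⟨List.nodup_range.map_on fun k hk k' hk' he => ?_, ih hl' hn', ?_⟩
    · rw [List.mem_range] at hk hk'
      have hne := hab.ne
      unfold arcVertex at he
      split_ifs at he <;> simp only [Prod.mk.injEq] at he <;> omega
    · intro x hx y hy hxy
      subst hxy
      obtain ⟨k, hk, rfl⟩ := List.mem_map.1 hx
      rw [List.mem_range] at hk
      rcases Nat.eq_zero_or_pos k with rfl | hk0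
      · rcases mem_expand hy with ⟨c, hc, he⟩ | ⟨a', b', k', hi, hk1, hk1', he⟩
        · rw [arcVertex_zero, Prod.mk.injEq] at he
          exact ha (he.1 ▸ hc)
        · exact arcVertex_ne_zero hk1 hk1' (by rw [← he]; rfl)
      · rcases mem_expand hy with ⟨c, hc, he⟩ | ⟨a', b', k', hi, hk1, hk1', he⟩
        · exact arcVertex_ne_zero (L := L) (a := a) (b := b) hk0 (by omega) (by rw [he])
        · have h1 : a' ∈ b :: l := hi.subset (by simp)
          have h2 : b' ∈ b :: l := hi.subset (by simp)
          rcases arcVertex_inner_eq hk0 (by omega) he (by omega) with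
            ⟨rfl, rfl, rfl⟩ | ⟨rfl, rfl, rfl⟩
          · exact ha h1
          · exact ha h2

/-- The expansion of a path is an induced path: every edge of the subdivision has a subdivision
vertex, and a subdivision vertex on the path has both of its neighbours next to it. -/
theorem infix_expand_of_link (h : EdgeListed g n L E) {l : List ℕ} (hl : l.IsChain g.Adj)
    (hn : ∀ a ∈ l, a < n) {x y : Label} (hx : x ∈ expand L l) (hy : y ∈ expand L l)
    (hxy : linkAdj L x y = true) : [x, y] <:+: expand L l ∨ [y, x] <:+: expand L l := by
  obtain ⟨a, b, k, hab, hk, rfl, rfl⟩ :=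
    (h.linkAdj_iff (h.expand_subset hl hn hx) (h.expand_subset hl hn hy)).1 hxy
  have hL := h.one_le hab
  have key : ∀ j, 1 ≤ j → j ≤ 2 * L → arcVertex L a b j ∈ expand L l →
      [a, b] <:+: l ∨ [b, a] <:+: l := by
    intro j hj hj' hm
    rcases mem_expand hm with ⟨c, hc, he⟩ | ⟨a', b', k', hi, hk1, hk1', he⟩
    · exact absurd (by rw [he]) (arcVertex_ne_zero (a := a) (b := b) hj hj')
    · rcases arcVertex_inner_eq hj hj' he (by omega) with ⟨rfl, rfl, -⟩ | ⟨rfl, rfl, -⟩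
      · exact .inl hi
      · exact .inr hi
  have hi : [a, b] <:+: l ∨ [b, a] <:+: l := by
    rcases Nat.eq_zero_or_pos k with rfl | hk0
    · exact key _ (by omega) (by omega) hy
    · exact key _ hk0 hk hx
  rcases hi with hi | hi
  · exact .inl (infix_expand hi hk)
  · right
    have := infix_expand (L := L) (k := 2 * L - k) hi (by omega)
    rwa [show 2 * L - k = 2 * L + 1 - (k + 1) by omega, arcVertex_symm hab.ne (by omega),
      show 2 * L + 1 - (k + 1) + 1 = 2 * L + 1 - k by omega,
      arcVertex_symm hab.ne (by omega)] at this

end EdgeListed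

/-! ### Depth-first search -/

/-- If the stacks of adjacent vertices are comparable, a path has a vertex whose stack is contained in
the stacks of all its vertices. -/
theorem exists_suffix_root {g : SimpleGraph ℕ} {stk : ℕ → List ℕ} {l : List ℕ} (hne : l ≠ [])
    (hl : l.IsChain g.Adj) (hs : ∀ x ∈ l, ∀ y ∈ l, g.Adj x y → stk x <:+ stk y ∨ stk y <:+ stk x) :
    ∃ z ∈ l, ∀ y ∈ l, stk z <:+ stk y := by
  induction l with
  | nil => exact absurd rfl hne
  | cons x l ih =>
    rcases l with _ | ⟨y, l⟩
    · exact ⟨x, by simp, by simp⟩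
    · obtain ⟨hxy, hl'⟩ := List.isChain_cons_cons.1 hl
      obtain ⟨z, hz, hzl⟩ := ih (by simp) hl' fun a ha b hb =>
        hs a (List.mem_cons_of_mem _ ha) b (List.mem_cons_of_mem _ hb)
      have hzy := hzl y List.mem_cons_self
      have key : stk z <:+ stk x ∨ stk x <:+ stk z := by
        rcases hs x List.mem_cons_self y (by simp) hxy with h | h
        · exact List.suffix_or_suffix_of_suffix hzy h
        · exact .inl (hzy.trans h)
      rcases key with h | h
      · exact ⟨z, List.mem_cons_of_mem _ hz, List.forall_mem_cons.2 ⟨h, hzl⟩⟩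
      · exact ⟨x, List.mem_cons_self, List.forall_mem_cons.2
          ⟨List.suffix_rfl, fun w hw => h.trans (hzl w hw)⟩⟩

/-- If the search stacks at the times when vertices are reached have at most `i + d` elements, then
a path on which all of them have more than `i` elements has fewer than `2 ^ d` vertices: removing
its vertex of smallest depth leaves two paths of larger depth. -/
theorem length_lt_two_pow {g : SimpleGraph ℕ} {stk : ℕ → List ℕ} (d : ℕ) (i : ℕ) {l : List ℕ}
    (hl : l.IsChain g.Adj) (hn : l.Nodup)
    (hs : ∀ x ∈ l, ∀ y ∈ l, g.Adj x y → stk x <:+ stk y ∨ stk y <:+ stk x)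
    (hh : ∀ x ∈ l, (stk x).head? = some x)
    (hi : ∀ x ∈ l, i < (stk x).length ∧ (stk x).length ≤ i + d) : l.length + 1 ≤ 2 ^ d := by
  induction d generalizing i l with
  | zero =>
    rcases l with _ | ⟨x, l⟩
    · simp
    · have := hi x List.mem_cons_self
      omega
  | succ d ih =>
    rcases eq_or_ne l [] with rfl | hne
    · simp [Nat.one_le_two_pow]
    obtain ⟨z, hz, hzl⟩ := exists_suffix_root hne hl hs
    obtain ⟨l₁, l₂, rfl⟩ := List.append_of_mem hz
    have hlt : ∀ y ∈ l₁ ++ z :: l₂, y ≠ z → i + 1 < (stk y).length := by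
      intro y hy hyz
      have h1 := (hi z hz).1
      have h2 := hzl y hy
      by_contra h3
      have h4 : stk z = stk y := h2.eq_of_length_le (by omega)
      have h5 := hh y hy
      rw [← h4, hh z hz, Option.some.injEq] at h5
      exact hyz h5.symm
    have hn' := List.nodup_append.1 hn
    have key : ∀ l' : List ℕ, l' <:+: l₁ ++ z :: l₂ → z ∉ l' → l'.length + 1 ≤ 2 ^ d := by
      intro l' hi' hz'
      refine ih (i + 1) (hl.infix hi') (hn.sublist hi'.sublist)
        (fun x hx y hy => hs x (hi'.subset hx) y (hi'.subset hy))
        (fun x hx => hh x (hi'.subset hx)) fun x hx => ?_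
      have h1 := hi x (hi'.subset hx)
      exact ⟨hlt x (hi'.subset hx) (fun h => hz' (h ▸ hx)), by omega⟩
    have h1 := key l₁ (List.prefix_append _ _).isInfix fun h => hn'.2.2 z h z (by simp) rfl
    have h2 := key l₂ ⟨l₁ ++ [z], [], by simp⟩ (List.nodup_cons.1 hn'.2.1).1
    rw [List.length_append, List.length_cons, pow_succ]
    omega

/-- The invariant of the depth-first search: `stk x` is the stack at the time when `x` is reached,
and vertices that are visited but not on the stack have only visited neighbours. -/
structure DfsInvariant (g : SimpleGraph ℕ) (n : ℕ) (S V : List ℕ) (D : ℕ) (stk : ℕ → List ℕ) :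
    Prop where
  subset : ∀ x ∈ S, x ∈ V
  nodup_visited : V.Nodup
  lt : ∀ x ∈ V, x < n
  chain : S.IsChain g.Adj
  nodup : S.Nodup
  head : ∀ x ∈ V, (stk x).head? = some x
  length_le : ∀ x ∈ V, (stk x).length ≤ D
  suffix : ∀ x ∈ S, stk x <:+ S
  finished : ∀ x ∈ V, x ∉ S → ∀ y, g.Adj x y → y ∈ V
  comparable : ∀ x ∈ V, ∀ y ∈ V, g.Adj x y → stk x <:+ stk y ∨ stk y <:+ stk x

variable {g : SimpleGraph ℕ} {M : List (List Bool)} {D : ℕ}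

theorem mem_dfsNext {S V : List ℕ} {y : ℕ} : y ∈ dfsNext M (S, V) ↔
    y < M.length ∧ y ∉ V ∧ (S = [] ∨ matAdj M (S.headD 0) y = true) := by
  simp only [dfsNext, List.mem_filter, List.mem_range, Bool.and_eq_true, Bool.not_eq_true',
    List.any_eq_false, decide_eq_true_eq, Bool.or_eq_true, List.isEmpty_iff]
  have h : (∀ x ∈ V, ¬ x = y) ↔ y ∉ V :=
    ⟨fun h hy => h y hy rfl, fun h x hx e => h (e ▸ hx)⟩
  rw [h]

theorem DfsInvariant.step (hM : ∀ a b, matAdj M a b = true ↔ g.Adj a b)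
    (hlt : ∀ {a b}, g.Adj a b → a < M.length) {S V : List ℕ} {stk : ℕ → List ℕ}
    (h : DfsInvariant g M.length S V D stk) (hD : (dfsStep M (S, V)).1.length ≤ D) :
    ∃ stk', DfsInvariant g M.length (dfsStep M (S, V)).1 (dfsStep M (S, V)).2 D stk' := by
  rcases hc : dfsNext M (S, V) with _ | ⟨y, l⟩
  · have hstep : dfsStep M (S, V) = (S.tail, V) := by simp [dfsStep, hc]
    rw [hstep]
    refine ⟨stk, ⟨fun x hx => h.subset x (List.mem_of_mem_tail hx), h.nodup_visited, h.lt,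
      h.chain.tail, h.nodup.tail, h.head, h.length_le, ?_, ?_, h.comparable⟩⟩
    · intro x hx
      rcases S with _ | ⟨z, S⟩
      · simp at hx
      · have hx' : x ∈ S := hx
        rcases List.suffix_cons_iff.1 (h.suffix x (List.mem_cons_of_mem _ hx')) with h1 | h1
        · have h2 := h.head x (h.subset x (List.mem_cons_of_mem _ hx'))
          rw [h1, List.head?_cons, Option.some.injEq] at h2
          exact absurd (h2 ▸ hx') (List.nodup_cons.1 h.nodup).1
        · exact h1
    · intro x hxV hxS y hxy
      by_cases hx : x ∈ S
      · rcases S with _ | ⟨z, S⟩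
        · simp at hx
        · obtain rfl : x = z := (List.mem_cons.1 hx).resolve_right hxS
          by_contra hy
          have : y ∈ dfsNext M (x :: S, V) :=
            mem_dfsNext.2 ⟨hlt hxy.symm, hy, .inr ((hM _ _).2 hxy)⟩
          rw [hc] at this
          simp at this
      · exact h.finished x hxV hx y hxy
  · have hstep : dfsStep M (S, V) = (y :: S, y :: V) := by simp [dfsStep, hc]
    rw [hstep] at hD ⊢
    obtain ⟨hyn, hyV, hyS⟩ := mem_dfsNext.1 (hc ▸ List.mem_cons_self : y ∈ dfsNext M (S, V))
    have hyS' : y ∉ S := fun hy => hyV (h.subset y hy)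
    have hne : ∀ x ∈ V, x ≠ y := fun x hx hxy => hyV (hxy ▸ hx)
    have hstk : ∀ x ∈ V, Function.update stk y (y :: S) x = stk x := fun x hx =>
      Function.update_of_ne (hne x hx) _ _
    have hnew : ∀ x ∈ V, g.Adj x y → stk x <:+ y :: S := by
      intro x hx hxy
      have hxS : x ∈ S := by
        by_contra hxS
        exact hyV (h.finished x hx hxS y hxy)
      exact (h.suffix x hxS).trans (List.suffix_cons _ _)
    refine ⟨Function.update stk y (y :: S), ⟨?_, List.nodup_cons.2 ⟨hyV, h.nodup_visited⟩, ?_, ?_,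
      List.nodup_cons.2 ⟨hyS', h.nodup⟩, ?_, ?_, ?_, ?_, ?_⟩⟩
    · intro x hx
      rcases List.mem_cons.1 hx with rfl | hx
      · exact List.mem_cons_self
      · exact List.mem_cons_of_mem _ (h.subset x hx)
    · exact List.forall_mem_cons.2 ⟨hyn, h.lt⟩
    · refine List.isChain_cons.2 ⟨fun z hz => ?_, h.chain⟩
      rcases S with _ | ⟨w, S⟩
      · simp at hz
      · simp only [List.head?_cons, Option.mem_some_iff] at hz
        subst hz
        exact ((hM _ _).1 (hyS.resolve_left (by simp))).symm
    · refine List.forall_mem_cons.2 ⟨by simp, fun x hx => ?_⟩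
      rw [hstk x hx]
      exact h.head x hx
    · refine List.forall_mem_cons.2 ⟨by simpa using hD, fun x hx => ?_⟩
      rw [hstk x hx]
      exact h.length_le x hx
    · refine List.forall_mem_cons.2 ⟨by simp, fun x hx => ?_⟩
      rw [hstk x (h.subset x hx)]
      exact (h.suffix x hx).trans (List.suffix_cons _ _)
    · intro x hx hxS z hxz
      have hx' : x ∈ V := (List.mem_cons.1 hx).resolve_left fun h => hxS (h ▸ List.mem_cons_self)
      exact List.mem_cons_of_mem _
        (h.finished x hx' (fun h => hxS (List.mem_cons_of_mem _ h)) z hxz)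
    · intro x hx z hz hxz
      rcases List.mem_cons.1 hx with rfl | hx' <;> rcases List.mem_cons.1 hz with rfl | hz'
      · exact absurd hxz (g.irrefl)
      · right
        rw [hstk z hz', Function.update_self]
        exact hnew z hz' hxz.symm
      · left
        rw [hstk x hx', Function.update_self]
        exact hnew x hx' hxz
      · rw [hstk x hx', hstk z hz']
        exact h.comparable x hx' z hz' hxz

theorem dfsInvariant_iterate (hM : ∀ a b, matAdj M a b = true ↔ g.Adj a b)
    (hlt : ∀ {a b}, g.Adj a b → a < M.length) (t : ℕ)
    (hD : ∀ s ≤ t, ((dfsStep M)^[s] ([], [])).1.length ≤ D) :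
    ∃ stk, DfsInvariant g M.length ((dfsStep M)^[t] ([], [])).1 ((dfsStep M)^[t] ([], [])).2 D
      stk := by
  induction t with
  | zero => exact ⟨fun _ => [], by constructor <;> simp⟩
  | succ t ih =>
    obtain ⟨stk, h⟩ := ih fun s hs => hD s (by omega)
    have h1 := hD (t + 1) le_rfl
    rw [Function.iterate_succ_apply'] at h1 ⊢
    exact h.step hM hlt h1

theorem dfs_progress (t : ℕ) : ((∀ y < M.length, y ∈ ((dfsStep M)^[t] ([], [])).2) ∧
      ((dfsStep M)^[t] ([], [])).1 = []) ∨
    t + ((dfsStep M)^[t] ([], [])).1.length ≤ 2 * ((dfsStep M)^[t] ([], [])).2.length := by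
  induction t with
  | zero => simp
  | succ t ih =>
    rw [Function.iterate_succ_apply']
    generalize (dfsStep M)^[t] ([], []) = x at *
    obtain ⟨S, V⟩ := x
    rcases hc : dfsNext M (S, V) with _ | ⟨y, l⟩
    · rw [show dfsStep M (S, V) = (S.tail, V) by simp [dfsStep, hc]]
      rcases ih with ⟨h1, h2⟩ | h1
      · left
        simp only at h1 h2
        exact ⟨h1, by simp [h2]⟩
      · rcases S with _ | ⟨z, S⟩
        · refine .inl ⟨fun y hy => ?_, rfl⟩
          by_contra hyV
          have : y ∈ dfsNext M ([], V) := mem_dfsNext.2 ⟨hy, hyV, .inl rfl⟩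
          rw [hc] at this
          simp at this
        · right
          simp only [List.tail_cons, List.length_cons] at *
          omega
    · rw [show dfsStep M (S, V) = (y :: S, y :: V) by simp [dfsStep, hc]]
      have hy := mem_dfsNext.1 (hc ▸ List.mem_cons_self : y ∈ dfsNext M (S, V))
      rcases ih with ⟨h1, h2⟩ | h1
      · exact absurd (h1 y hy.1) hy.2.1
      · right
        simp only [List.length_cons] at *
        omega

theorem isPath_of_mem_dfsStacks (hM : ∀ a b, matAdj M a b = true ↔ g.Adj a b)
    (hlt : ∀ {a b}, g.Adj a b → a < M.length) {S : List ℕ} (hS : S ∈ dfsStacks M) :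
    S.IsChain g.Adj ∧ S.Nodup ∧ ∀ a ∈ S, a < M.length := by
  obtain ⟨t, -, rfl⟩ := List.mem_map.1 hS
  have hD : ∃ D, ∀ s ≤ t, ((dfsStep M)^[s] ([], [])).1.length ≤ D :=
    ⟨(Finset.range (t + 1)).sup fun s => ((dfsStep M)^[s] ([], [])).1.length, fun s hs =>
      Finset.le_sup (f := fun s => ((dfsStep M)^[s] ([], [])).1.length)
        (Finset.mem_range.2 (by omega))⟩
  obtain ⟨D, hD⟩ := hD
  obtain ⟨stk, h⟩ := dfsInvariant_iterate hM hlt t hD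
  exact ⟨h.chain, h.nodup, fun a ha => h.lt a (h.subset a ha)⟩

/-- If all stacks of the depth-first search have at most `D` elements, then paths have fewer than
`2 ^ D` vertices. -/
theorem length_lt_of_dfsStacks (hM : ∀ a b, matAdj M a b = true ↔ g.Adj a b)
    (hlt : ∀ {a b}, g.Adj a b → a < M.length) (hD : ∀ S ∈ dfsStacks M, S.length ≤ D)
    {l : List ℕ} (hl : l.IsChain g.Adj) (hn : l.Nodup) (hln : ∀ a ∈ l, a < M.length) :
    l.length + 1 ≤ 2 ^ D := by
  obtain ⟨stk, h⟩ := dfsInvariant_iterate (D := D) hM hlt (2 * M.length) fun s hs =>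
    hD _ (List.mem_map.2 ⟨s, List.mem_range.2 (by omega), rfl⟩)
  have hall : ∀ y < M.length, y ∈ ((dfsStep M)^[2 * M.length] ([], [])).2 := by
    rcases dfs_progress (M := M) (2 * M.length) with ⟨h1, -⟩ | h1
    · exact h1
    · have h2 : ((dfsStep M)^[2 * M.length] ([], [])).2 ⊆ List.range M.length :=
        fun x hx => List.mem_range.2 (h.lt x hx)
      have h3 := h.nodup_visited.subperm h2
      have h4 := h3.perm_of_length_le (by rw [List.length_range]; omega)
      exact fun y hy => h4.mem_iff.2 (List.mem_range.2 hy)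
  refine length_lt_two_pow D 0 hl hn
    (fun x hx y hy => h.comparable x (hall x (hln x hx)) y (hall y (hln y hy)))
    (fun x hx => h.head x (hall x (hln x hx))) fun x hx => ⟨?_, ?_⟩
  · have := h.head x (hall x (hln x hx))
    rw [List.length_pos_iff]
    rintro h0
    simp [h0] at this
  · rw [zero_add]
    exact h.length_le x (hall x (hln x hx))

theorem longest_spec (l : List (List ℕ)) :
    (longest l = [] ∨ longest l ∈ l) ∧ ∀ a ∈ l, a.length ≤ (longest l).length := by
  suffices h : ∀ (l : List (List ℕ)) (b : List ℕ),
      (l.foldl (fun a b => if a.length < b.length then b else a) b = b ∨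
        l.foldl (fun a b => if a.length < b.length then b else a) b ∈ l) ∧
      b.length ≤ (l.foldl (fun a b => if a.length < b.length then b else a) b).length ∧
      ∀ a ∈ l, a.length ≤
        (l.foldl (fun a b => if a.length < b.length then b else a) b).length from
    ⟨(h l []).1, (h l []).2.2⟩
  intro l
  induction l with
  | nil => simp
  | cons c l ih =>
    intro b
    rw [List.foldl_cons]
    obtain ⟨h1, h2, h3⟩ := ih (if b.length < c.length then c else b)
    refine ⟨?_, ?_, List.forall_mem_cons.2 ⟨?_, h3⟩⟩
    · rcases h1 with h1 | h1
      · rw [h1]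
        split_ifs <;> simp
      · exact .inr (List.mem_cons_of_mem _ h1)
    · refine le_trans ?_ h2
      split_ifs <;> omega
    · refine le_trans ?_ h2
      split_ifs <;> omega

/-! ### Programs built around a given program -/

section

variable {α β γ δ : Type} [Enc α] [Enc β] [Enc γ] [Enc δ]

/-- A program that solves the instances `F a` is turned into one that, for each `a`, computes
`E (a, c)` from some solution `c` of `F a`. -/
theorem exists_prog_of_reduction {F : α → β} {E : α × γ → δ} (hF : PolyTime F) (hE : PolyTime E)
    (A : Prog) (P : Polynomial ℕ) : ∃ (B : Prog) (Q : Polynomial ℕ), ∀ (a : α) (Good : γ → Prop),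
      A.SolvesWithin P (enc (F a)) (fun y => ∃ c, y = enc c ∧ Good c) →
        B.SolvesWithin Q (enc a) fun z => ∃ c, Good c ∧ z = enc (E (a, c)) := by
  obtain ⟨pF, PF, hF⟩ := hF
  obtain ⟨pE, PE, hE⟩ := hE
  let X : Polynomial ℕ := Polynomial.X
  -- bounds for the time of the first two programs, and for the size of what they write
  let T : Polynomial ℕ := PF + P.comp (X + PF)
  let K : Polynomial ℕ := 2 * X + T + 1
  refine ⟨.seq (.cons .id (.seq pF A)) pE, T + 3 + K + PE.comp K, fun a Good hA => ?_⟩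
  obtain ⟨y, tA, hrA, htA, c, rfl, hc⟩ := hA
  obtain ⟨tF, hrF, htF⟩ := hF a
  obtain ⟨tE, hrE, htE⟩ := hE (a, c)
  refine ⟨_, _, .seq (.cons (.id _) (.seq hrF hrA)) hrE, ?_, c, hc, rfl⟩
  have h1 : (enc (F a)).size ≤ (enc a).size + PF.eval (enc a).size :=
    hrF.size_le.trans (Nat.add_le_add_left htF _)
  have h2 := P.eval_mono_nat h1
  have h3 := hrA.size_le
  have h4 : (Data.cons (enc a) (enc c)).size ≤ K.eval (enc a).size := by
    simp only [K, T, X, Data.size, Polynomial.eval_add, Polynomial.eval_mul, Polynomial.eval_X,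
      Polynomial.eval_comp, Polynomial.eval_one, Polynomial.eval_ofNat]
    omega
  have h5 := PE.eval_mono_nat h4
  change tE ≤ PE.eval (Data.cons (enc a) (enc c)).size at htE
  change tF ≤ PF.eval (enc a).size at htF
  simp only [T, X, Polynomial.eval_add, Polynomial.eval_X, Polynomial.eval_comp,
    Polynomial.eval_ofNat] at h5 h4 ⊢
  omega

end

/-! ### Encoding a graph and its subdivision -/

open Classical in
/-- The adjacency matrix of a graph. -/
noncomputable def adjRows {n : ℕ} (G : SimpleGraph (Fin n)) : List (List Bool) :=
  relMatrix (fun i j => decide (G.Adj i j)) (List.finRange n)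

/-- A graph on `{0, …, n - 1}` as a graph on the natural numbers. -/
def natGraph {n : ℕ} (G : SimpleGraph (Fin n)) : SimpleGraph ℕ := G.map Fin.valEmbedding

section

variable {n : ℕ} (G : SimpleGraph (Fin n))

open Classical in
theorem ofProp_eq_enc (p : Prop) : Data.ofProp p = enc (decide p) := by
  by_cases h : p <;> simp [Data.ofProp, h, enc_true, enc_false]

theorem ofRel_eq_enc {α : Type} {R : α → α → Bool} {D : List α}
    {S : Fin D.length → Fin D.length → Prop} (h : ∀ i j, S i j ↔ R (D.get i) (D.get j) = true) :
    Data.ofRel S = enc (relMatrix R D) := by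
  classical
  conv_rhs => rw [← List.map_get_finRange D]
  simp only [Data.ofRel, relMatrix, List.map_map, Function.comp_def, ofProp_eq_enc, h,
    Bool.decide_eq_true, enc_map]

theorem enc_adjRows : enc (adjRows G) = encodeGraph G := by
  classical
  simp only [encodeGraph, Data.ofRel, adjRows, relMatrix, ofProp_eq_enc, enc_map]

@[simp] theorem length_adjRows : (adjRows G).length = n := by simp [adjRows, relMatrix]

theorem natGraph_adj {a b : ℕ} :
    (natGraph G).Adj a b ↔ ∃ (ha : a < n) (hb : b < n), G.Adj ⟨a, ha⟩ ⟨b, hb⟩ := by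
  rw [natGraph, SimpleGraph.map_adj]
  constructor
  · rintro ⟨u, v, h, rfl, rfl⟩
    exact ⟨u.2, v.2, h⟩
  · rintro ⟨ha, hb, h⟩
    exact ⟨_, _, h, rfl, rfl⟩

theorem lt_of_natGraph_adj {a b : ℕ} (h : (natGraph G).Adj a b) : a < n :=
  ((natGraph_adj G).1 h).1

theorem matAdj_adjRows (a b : ℕ) : matAdj (adjRows G) a b = true ↔ (natGraph G).Adj a b := by
  classical
  rw [natGraph_adj]
  by_cases ha : a < n
  · by_cases hb : b < n
    · simp [matAdj, adjRows, relMatrix, List.getD_eq_getElem?_getD, ha, hb]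
    · simp [matAdj, adjRows, relMatrix, List.getD_eq_getElem?_getD, ha, hb]
  · simp [matAdj, adjRows, relMatrix, List.getD_eq_getElem?_getD, ha]

theorem mem_edgeList {u v : ℕ} :
    (u, v) ∈ edgeList (adjRows G) ↔ u < v ∧ (natGraph G).Adj u v := by
  simp only [edgeList, List.mem_flatMap, List.mem_map, List.mem_filter, List.mem_range,
    Bool.and_eq_true, decide_eq_true_eq, matAdj_adjRows, length_adjRows, Prod.mk.injEq]
  constructor
  · rintro ⟨u, hu, v, ⟨-, h⟩, rfl, rfl⟩
    exact h
  · intro h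
    exact ⟨u, lt_of_natGraph_adj G h.2, v, ⟨lt_of_natGraph_adj G h.2.symm, h⟩, rfl, rfl⟩

theorem nodup_edgeList (M : List (List Bool)) : (edgeList M).Nodup := by
  refine List.nodup_flatMap.2 ⟨fun u _ => ?_, ?_⟩
  · exact (List.nodup_range.filter _).map fun a b h => by simpa using h
  · refine List.nodup_range.imp fun {u u'} hne => ?_
    intro x hx hx'
    obtain ⟨v, -, rfl⟩ := List.mem_map.1 hx
    obtain ⟨v', -, hv⟩ := List.mem_map.1 hx'
    exact hne (Prod.ext_iff.1 hv).1.symm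

theorem edgeListed : EdgeListed (natGraph G) n (Nat.clog 2 n) (edgeList (adjRows G)) where
  lt := lt_of_natGraph_adj G
  le_pow := Nat.le_pow_clog one_lt_two n
  mem_iff := mem_edgeList G
  nodup := nodup_edgeList _

theorem length_edgeList : (edgeList (adjRows G)).length = G.edgeSet.ncard := by
  classical
  rw [← List.toFinset_card_of_nodup (nodup_edgeList _), ← Set.ncard_coe_finset]
  have hinj : Function.Injective (Sym2.map (Fin.val : Fin n → ℕ)) :=
    Sym2.map.injective Fin.val_injective
  rw [← Set.ncard_image_of_injective _ hinj]
  refine Set.ncard_congr (fun e _ => s(e.1, e.2)) ?_ ?_ ?_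
  · rintro ⟨u, v⟩ h
    obtain ⟨-, h⟩ := (mem_edgeList G).1 (by simpa using h)
    obtain ⟨hu, hv, h⟩ := (natGraph_adj G).1 h
    exact ⟨s(⟨u, hu⟩, ⟨v, hv⟩), h, rfl⟩
  · rintro ⟨u, v⟩ ⟨u', v'⟩ h h' he
    have h1 := ((mem_edgeList G).1 (by simpa using h)).1
    have h2 := ((mem_edgeList G).1 (by simpa using h')).1
    simp only [Sym2.eq_iff, Prod.mk.injEq] at he ⊢
    omega
  · rintro _ ⟨e, he, rfl⟩
    induction e with
    | _ u v =>
      rw [SimpleGraph.mem_edgeSet] at he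
      have h1 : (natGraph G).Adj u v := (natGraph_adj G).2 ⟨u.2, v.2, he⟩
      rcases lt_or_gt_of_ne h1.ne with h | h
      · exact ⟨(u, v), by simpa using (mem_edgeList G).2 ⟨h, h1⟩, rfl⟩
      · exact ⟨(v, u), by simpa using (mem_edgeList G).2 ⟨h, h1.symm⟩, Sym2.eq_swap⟩

/-- The vertices of the subdivision of `G`. -/
noncomputable def subdivisionVertices : List Label :=
  vertexList n (Nat.clog 2 n) (edgeList (adjRows G))

/-- The replacements of labels that yield the partition sequence of the subdivision of `G`. -/
noncomputable def subdivisionSteps : List (Label × Label) :=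
  foldSteps (Nat.clog 2 n) (edgeList (adjRows G)) ++ treeSteps n (Nat.clog 2 n)

/-- The partition sequence of the subdivision of `G`. -/
noncomputable def subdivisionSeq : List (Setoid (Fin (subdivisionVertices G).length)) :=
  mergeSeq (subdivisionVertices G) (subdivisionSteps G) (subdivisionSteps G).length

/-- The subdivision of `G`. -/
noncomputable def subdivisionGraph : SimpleGraph (Fin (subdivisionVertices G).length) :=
  subdivision (Nat.clog 2 n) (subdivisionVertices G)

theorem length_subdivisionVertices : (subdivisionVertices G).length = subdividedOrder G := by
  rw [subdivisionVertices, length_vertexList, length_edgeList]; rfl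

theorem isTwinSequence_subdivisionSeq :
    IsTwinSequence (subdivisionGraph G) 4 (subdivisionSeq G) :=
  (edgeListed G).isTwinSequence_subdivision

theorem enc_mergeMatrices (D : List Label) (T : List (Label × Label)) :
    Data.ofList ((mergeSeq D T T.length).map fun s => Data.ofRel s.r) = enc (mergeMatrices D T) := by
  have h : ∀ f : Label → Label, Data.ofRel (Setoid.ker fun i => f (D.get i)).r =
      enc (relMatrix (fun x y => decide (x = y)) (D.map f)) := by
    intro f
    have h1 : relMatrix (fun x y => decide (x = y)) (D.map f) =
        relMatrix (fun x y => decide (f x = f y)) D := by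
      simp [relMatrix, Function.comp_def]
    rw [h1]
    exact ofRel_eq_enc fun i j => by rw [decide_eq_true_eq]; rfl
  have h0 := h id
  rw [List.map_id] at h0
  unfold mergeSeq mergeMatrices
  rw [enc_cons, ← h0, List.map_cons, Data.ofList]
  congr 1
  change Data.ofList _ = Data.ofList _
  rw [List.map_flatMap, List.map_flatMap]
  congr 2
  funext t
  split_ifs
  · simp only [List.map_cons, List.map_nil]
    rw [h fun x => (T.take (t + 1)).foldl relabel x]
  · rfl

theorem enc_subdivisionInput :
    encodeGraphSeq (subdivisionGraph G) (subdivisionSeq G) = enc (subdivisionInput (adjRows G)) := by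
  rw [encodeGraphSeq, subdivisionSeq, enc_mergeMatrices]
  unfold subdivisionInput
  rw [enc_pair, length_adjRows]
  congr 1
  exact ofRel_eq_enc fun i j => Iff.rfl

end

/-! ### The approximation ratio -/

theorem exists_path_of_list {V : Type*} {G : SimpleGraph V} {l : List V} (hne : l ≠ [])
    (hc : l.IsChain G.Adj) (hn : l.Nodup) :
    ∃ (u v : V) (p : G.Walk u v), p.IsPath ∧ p.support = l ∧ p.length + 1 = l.length :=
  ⟨_, _, .ofSupport l hne hc, .mk' (by rwa [SimpleGraph.Walk.support_ofSupport]),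
    SimpleGraph.Walk.support_ofSupport hne hc, by
      rw [SimpleGraph.Walk.length_ofSupport hne hc]
      have := List.length_pos_iff.2 hne
      omega⟩

theorem enc_map_val {n : ℕ} (l : List (Fin n)) : encodeVertices l = enc (l.map Fin.val) := by
  change Data.ofList (List.map Data.ofNat (List.flatMap (fun i : Fin n => [(i : ℕ)]) l)) = _
  rw [← List.map_eq_flatMap]; rfl

section

variable {n : ℕ} (G : SimpleGraph (Fin n))

theorem isChain_natGraph {l : List (Fin n)} :
    (l.map Fin.val).IsChain (natGraph G).Adj ↔ l.IsChain G.Adj := by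
  rw [List.isChain_map]
  have : (fun a b : Fin n => (natGraph G).Adj a b) = G.Adj := by
    ext a b
    rw [natGraph_adj]
    exact ⟨fun ⟨_, _, h⟩ => h, fun h => ⟨a.2, b.2, h⟩⟩
  rw [this]

/-- A path of `G` yields an induced path of the subdivision. -/
theorem exists_inducedPath_subdivision {u v : Fin n} (q : G.Walk u v) (hq : q.IsPath) :
    ∃ (u' v' : _) (q' : (subdivisionGraph G).Walk u' v'), IsInducedPath q' ∧
      q'.length = (2 * Nat.clog 2 n + 1) * q.length := by
  have h := edgeListed G
  set L := Nat.clog 2 n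
  set l := q.support.map Fin.val with hl
  have hc : l.IsChain (natGraph G).Adj := (isChain_natGraph G).2 q.isChain_adj_support
  have hn : l.Nodup := hq.support_nodup.map Fin.val_injective
  have hlt : ∀ a ∈ l, a < n := by
    intro a ha
    obtain ⟨i, -, rfl⟩ := List.mem_map.1 ha
    exact i.2
  obtain ⟨w, hw⟩ : ∃ w : List (Fin (subdivisionVertices G).length),
      w.map (subdivisionVertices G).get = expand L l := by
    have : expand L l ∈ Set.range (List.map (subdivisionVertices G).get) := by
      rw [Set.range_list_map]
      exact fun x hx => List.mem_iff_get.1 (h.expand_subset hc hlt hx)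
    exact this
  have hwc : w.IsChain (subdivisionGraph G).Adj := by
    have := h.isChain_expand hc
    rw [← hw, List.isChain_map] at this
    exact this
  have hwn : w.Nodup := by
    have := EdgeListed.nodup_expand L hc hn
    rw [← hw] at this
    exact this.of_map _
  have hlen : w.length = (2 * L + 1) * q.length + 1 := by
    obtain ⟨a, l', hal⟩ : ∃ a l', l = a :: l' :=
      List.exists_cons_of_ne_nil (by simp [hl])
    have h1 : l.length = q.length + 1 := by simp [hl]
    rw [← List.length_map (subdivisionVertices G).get, hw, hal, length_expand]
    rw [hal, List.length_cons] at h1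
    rw [show l'.length = q.length by omega]
  obtain ⟨u', v', p, hp, hps, hpl⟩ := exists_path_of_list (by rintro rfl; simp at hlen) hwc hwn
  refine ⟨u', v', p, ⟨hp, ?_⟩, by omega⟩
  intro i hi j hj hij
  rw [SimpleGraph.Walk.mem_verts_toSubgraph, hps] at hi hj
  rw [SimpleGraph.Walk.adj_toSubgraph_iff_mem_edges,
    ← SimpleGraph.Walk.infix_support_iff_mem_edges, hps]
  have hget : Function.Injective (subdivisionVertices G).get :=
    List.nodup_iff_injective_get.1 h.nodup_vertexList
  have key : ∀ i j, [(subdivisionVertices G).get i, (subdivisionVertices G).get j] <:+: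
      expand L l → [i, j] <:+: w := by
    rintro i j ⟨A, B, hAB⟩
    rw [← hw] at hAB
    obtain ⟨w₁, B', rfl, h1, rfl⟩ := List.map_eq_append_iff.1 hAB.symm
    obtain ⟨A', w₂, rfl, rfl, h2⟩ := List.map_eq_append_iff.1 h1
    have : w₂ = [i, j] := hget.list_map (by simpa using h2)
    exact ⟨A', B', by rw [this]⟩
  refine (h.infix_expand_of_link hc hlt ?_ ?_ hij).imp (key i j) (key j i)
  · rw [← hw]
    exact List.mem_map_of_mem hi
  · rw [← hw]
    exact List.mem_map_of_mem hj

theorem branches_map_get (w : List (Fin (subdivisionVertices G).length)) :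
    branches (w.map (subdivisionVertices G).get) =
      (w.map Fin.val).filter fun i => decide (i < n) := by
  induction w with
  | nil => rfl
  | cons i w ih =>
    rw [List.map_cons, branches_cons, ih, List.map_cons, List.filter_cons]
    by_cases hi : (i : ℕ) < n
    · have : (subdivisionVertices G).get i = ((i : ℕ), (i : ℕ), 0) := by
        change (subdivisionVertices G)[(i : ℕ)] = _
        simp [subdivisionVertices, vertexList, hi]
      rw [this]
      simp [hi]
    · have h1 : (subdivisionVertices G).get i ∈
          innerList (Nat.clog 2 n) (edgeList (adjRows G)) := by
        change (subdivisionVertices G)[(i : ℕ)] ∈ _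
        simp [subdivisionVertices, vertexList, List.getElem_append, hi]
      obtain ⟨u, v, k, -, hk, -, h2⟩ := mem_innerList.1 h1
      rw [h2, if_neg (by simp; omega)]
      simp [hi]

/-- From a path of the subdivision that approximates its longest induced paths, a path of `G` is
obtained that is, up to the two ends, at least as good an approximation, and that is at least
logarithmically long. -/
theorem exists_path_extractPath (hn : 0 < n) {R : ℝ} {u v : _} (p : (subdivisionGraph G).Walk u v)
    (hp : p.IsPath) (hR : ∀ (u' v' : _) (q : (subdivisionGraph G).Walk u' v'), IsInducedPath q →
      (q.length : ℝ) ≤ R * p.length) :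
    ∃ (u' v' : Fin n) (p' : G.Walk u' v'), p'.IsPath ∧
      encodeVertices p'.support = enc (extractPath (adjRows G) (p.support.map Fin.val)) ∧
      ∀ (u'' v'' : Fin n) (q : G.Walk u'' v''), q.IsPath →
        q.length + 2 ≤ 2 ^ (p'.length + 1) ∧
        (0 < q.length → 0 < R ∧ (q.length : ℝ) ≤ R * (p'.length + 2)) := by
  have h := edgeListed G
  set B := extractPath (adjRows G) (p.support.map Fin.val) with hB
  -- the path of `G` on the original vertices of `p`
  have hb := h.branches_of_path (Q := p.support.map (subdivisionVertices G).get)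
    (by rw [List.isChain_map]; exact p.isChain_adj_support)
    (hp.support_nodup.map (List.nodup_iff_injective_get.1 h.nodup_vertexList))
    (by
      intro y hy
      obtain ⟨i, -, rfl⟩ := List.mem_map.1 hy
      exact List.get_mem _ _)
  rw [branches_map_get, List.length_map, SimpleGraph.Walk.length_support] at hb
  set F := (p.support.map Fin.val).filter fun i => decide (i < n) with hF
  have hBF : B = longest (F :: dfsStacks (adjRows G)) := by
    rw [hB, extractPath, length_adjRows]
  obtain ⟨hmem, hmax⟩ := longest_spec (F :: dfsStacks (adjRows G))
  rw [← hBF] at hmem hmax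
  have hmat := matAdj_adjRows G
  have hlt : ∀ {a b}, (natGraph G).Adj a b → a < (adjRows G).length := fun h => by
    rw [length_adjRows]; exact lt_of_natGraph_adj G h
  have hdfs : ∀ {l : List ℕ}, l.IsChain (natGraph G).Adj → l.Nodup → (∀ a ∈ l, a < n) →
      l.length + 1 ≤ 2 ^ B.length := by
    intro l hl hln hla
    refine length_lt_of_dfsStacks hmat hlt (fun S hS => hmax S (List.mem_cons_of_mem _ hS)) hl hln ?_
    rwa [length_adjRows]
  have hB0 : B ≠ [] := by
    intro h0
    have := hdfs (l := [0]) (by simp) (by simp) (by simpa using hn)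
    simp [h0] at this
  have hBpath : B.IsChain (natGraph G).Adj ∧ B.Nodup ∧ ∀ a ∈ B, a < n := by
    rcases List.mem_cons.1 (hmem.resolve_left hB0) with h1 | h1
    · rw [h1]
      exact ⟨hb.2.1, hb.2.2, fun a ha => by simpa using (List.mem_filter.1 ha).2⟩
    · have := isPath_of_mem_dfsStacks hmat hlt h1
      rwa [length_adjRows] at this
  obtain ⟨w, hw⟩ : ∃ w : List (Fin n), w.map Fin.val = B := by
    have : B ∈ Set.range (List.map (Fin.val : Fin n → ℕ)) := by
      rw [Set.range_list_map]
      exact fun x hx => ⟨⟨x, hBpath.2.2 x hx⟩, rfl⟩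
    exact this
  obtain ⟨u', v', p', hp', hps, hpl⟩ := exists_path_of_list (G := G) (l := w)
    (by rintro rfl; exact hB0 hw.symm)
    ((isChain_natGraph G).1 (hw ▸ hBpath.1)) ((hw ▸ hBpath.2.1 : (w.map Fin.val).Nodup).of_map _)
  have hBl : B.length = p'.length + 1 := by rw [hpl, ← hw, List.length_map]
  refine ⟨u', v', p', hp', by rw [enc_map_val, hps, hw], fun u'' v'' q hq => ⟨?_, fun hq0 => ?_⟩⟩
  · have := hdfs (l := q.support.map Fin.val) ((isChain_natGraph G).2 q.isChain_adj_support)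
      (hq.support_nodup.map Fin.val_injective) (by
        intro a ha
        obtain ⟨i, -, rfl⟩ := List.mem_map.1 ha
        exact i.2)
    rw [List.length_map, SimpleGraph.Walk.length_support, hBl] at this
    exact this
  · obtain ⟨x, y, q', hq', hql⟩ := exists_inducedPath_subdivision G q hq
    have h1 := hR x y q' hq'
    rw [hql] at h1
    set s := 2 * Nat.clog 2 n + 1 with hs
    have hs0 : (0 : ℝ) < s := by rw [hs]; positivity
    have hq0' : (0 : ℝ) < q.length := by exact_mod_cast hq0
    push_cast at h1
    have hR0 : 0 < R := by
      by_contra hR0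
      have h2 : R * p.length ≤ 0 := mul_nonpos_of_nonpos_of_nonneg (not_lt.1 hR0) (by positivity)
      have h3 : 0 < (s : ℝ) * q.length := by positivity
      linarith
    refine ⟨hR0, ?_⟩
    have h2 : F.length ≤ p'.length + 1 := hBl ▸ hmax F List.mem_cons_self
    have h3 : p.length ≤ s * (p'.length + 2) := by
      have h4 : s * (F.length + 1) ≤ s * (p'.length + 2) := Nat.mul_le_mul_left _ (by omega)
      have h5 := hb.1
      omega
    have h4 : (p.length : ℝ) ≤ s * (p'.length + 2) := by exact_mod_cast h3
    have h5 : (s : ℝ) * q.length ≤ s * (R * (p'.length + 2)) :=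
      h1.trans ((mul_le_mul_of_nonneg_left h4 hR0.le).trans (le_of_eq (by ring)))
    exact le_of_mul_le_mul_left h5 hs0

end

/-- A function that tends to infinity so slowly that its exponential stays below `r` from each
argument on. -/
theorem exists_slow_function {r : ℕ → ℝ} (hr : Tendsto r atTop atTop) :
    ∃ K : ℕ → ℕ, Tendsto K atTop atTop ∧ (∀ n, 1 ≤ K n) ∧
      ∀ n, K n = 1 ∨ ∀ m ≥ n, (2 : ℝ) ^ K n ≤ r m := by
  classical
  let Q : ℕ → ℕ → Prop := fun n j => ∀ m ≥ n, (2 : ℝ) ^ (j + 1) ≤ r m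
  refine ⟨fun n => Nat.findGreatest (Q n) n + 1, ?_, fun n => Nat.le_add_left _ _, fun n => ?_⟩
  · rw [tendsto_atTop]
    intro b
    obtain ⟨n₀, hn₀⟩ := eventually_atTop.1 (hr.eventually_ge_atTop ((2 : ℝ) ^ (b + 1)))
    filter_upwards [eventually_ge_atTop (max n₀ b)] with n hn
    have : Q n b := fun m hm => hn₀ m (by omega)
    have := Nat.le_findGreatest (P := Q n) (by omega : b ≤ n) this
    omega
  · rcases Nat.eq_zero_or_pos (Nat.findGreatest (Q n) n) with h | h
    · exact .inl (congrArg (· + 1) h)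
    · exact .inr (Nat.findGreatest_of_ne_zero rfl h.ne')

/-- An algorithm for the subdivisions whose output approximates the longest induced paths suffices. -/
theorem longestPathApprox_of_subdivision {r : ℕ → ℝ} (hr : Tendsto r atTop atTop) (A : Prog)
    (P : Polynomial ℕ)
    (hA : ∀ (n : ℕ) (G : SimpleGraph (Fin n)), 0 < n →
      A.SolvesWithin P (encodeGraphSeq (subdivisionGraph G) (subdivisionSeq G)) fun y =>
        ∃ (u v : _) (p : (subdivisionGraph G).Walk u v), p.IsPath ∧ y = encodeVertices p.support ∧
          ∀ (u' v' : _) (q : (subdivisionGraph G).Walk u' v'), IsInducedPath q →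
            (q.length : ℝ) ≤ r (subdivisionVertices G).length * p.length) :
    ∃ δ : ℕ → ℝ, Tendsto δ atTop (𝓝 0) ∧
      LongestPathApprox (fun n G => (1 + δ n) * r (subdividedOrder G)) := by
  obtain ⟨K, hK, hK1, hKr⟩ := exists_slow_function hr
  refine ⟨fun n => 2 / K n, tendsto_const_nhds.div_atTop
    (tendsto_natCast_atTop_atTop.comp hK), ?_⟩
  obtain ⟨B, Q, hB⟩ := exists_prog_of_reduction PolyTime.subdivisionInput PolyTime.extractPath A P
  refine ⟨B, Q, fun n G hn => ?_⟩
  obtain ⟨y, t, hy, ht, hA⟩ := hA n G hn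
  rw [enc_subdivisionInput] at hy ht
  obtain ⟨u, v, p, hp, rfl, hR⟩ := hA
  rw [enc_map_val] at hy
  have hR' : ∀ (u' v' : _) (q : (subdivisionGraph G).Walk u' v'), IsInducedPath q →
      (q.length : ℝ) ≤ r (subdividedOrder G) * p.length := by
    rw [← length_subdivisionVertices]
    exact hR
  rw [← enc_adjRows]
  obtain ⟨z, t', hz, ht', c, rfl, rfl⟩ := hB (adjRows G) (· = p.support.map Fin.val)
    ⟨_, t, hy, ht, _, rfl, rfl⟩
  refine ⟨_, t', hz, ht', ?_⟩
  obtain ⟨u', v', p', hp', he, hq⟩ := exists_path_extractPath G hn p hp hR'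
  refine ⟨u', v', p', hp', he.symm, fun x y q hqp => ?_⟩
  obtain ⟨hlog, hlin⟩ := hq x y q hqp
  set R := r (subdividedOrder G)
  rcases Nat.eq_zero_or_pos p'.length with h0 | h0
  · have h1 : q.length = 0 := by
      rw [h0] at hlog
      omega
    simp [h0, h1]
  have hR0 : 0 < R := ((hq u' v' p' hp').2 h0).1
  have hk1 : (1 : ℝ) ≤ p'.length := by exact_mod_cast h0
  have hKn : (0 : ℝ) < K n := by exact_mod_cast hK1 n
  have hδ : 0 ≤ 2 / (K n : ℝ) * R * p'.length := by positivity
  have hsplit : (1 + 2 / (K n : ℝ)) * R * p'.length =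
      R * p'.length + 2 / (K n : ℝ) * R * p'.length := by ring
  rw [hsplit]
  rcases Nat.eq_zero_or_pos q.length with hq0 | hq0
  · rw [hq0]
    have : 0 ≤ R * p'.length := by positivity
    push_cast
    linarith
  rcases le_or_gt (K n) p'.length with hkK | hkK
  · -- for long paths, the loss at the two ends is negligible
    refine (hlin hq0).2.trans ?_
    have h1 : 2 ≤ 2 / (K n : ℝ) * p'.length := by
      rw [div_mul_eq_mul_div, le_div_iff₀ hKn]
      have : (K n : ℝ) ≤ p'.length := by exact_mod_cast hkK
      linarith
    have h2 := mul_le_mul_of_nonneg_left h1 hR0.le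
    nlinarith
  · -- if only short paths are found, all paths are shorter than `R`
    have h1 : (2 : ℝ) ^ K n ≤ R := by
      rcases hKr n with h | h
      · omega
      · exact h _ (by rw [subdividedOrder]; omega)
    have h2 : q.length ≤ 2 ^ K n :=
      (by omega : q.length ≤ 2 ^ (p'.length + 1)).trans (Nat.pow_le_pow_right two_pos hkK)
    have h3 : (q.length : ℝ) ≤ 2 ^ K n := by exact_mod_cast h2
    have h4 : R ≤ R * p'.length := le_mul_of_one_le_right hR0.le hk1
    linarith

theorem mainTheorem9 (r : ℕ → ℝ) (hr : Tendsto r atTop atTop)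
    (h : LongestPathApproxGivenSequence 4 r ∨ LongestInducedPathApproxGivenSequence 4 r) :
    ∃ δ : ℕ → ℝ, Tendsto δ atTop (𝓝 0) ∧
      LongestPathApprox (fun n G => (1 + δ n) * r (subdividedOrder G)) := by
  have hpos : ∀ {n : ℕ} (G : SimpleGraph (Fin n)), 0 < n → 0 < (subdivisionVertices G).length := by
    intro n G hn
    rw [length_subdivisionVertices, subdividedOrder]
    omega
  rcases h with ⟨A, P, h⟩ | ⟨A, P, h⟩
  · refine longestPathApprox_of_subdivision hr A P fun n G hn => ?_
    obtain ⟨y, t, hy, ht, u, v, p, hp, he, hq⟩ :=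
      h _ (subdivisionGraph G) (subdivisionSeq G) (hpos G hn) (isTwinSequence_subdivisionSeq G)
    exact ⟨y, t, hy, ht, u, v, p, hp, he, fun u' v' q hi => hq u' v' q hi.1⟩
  · refine longestPathApprox_of_subdivision hr A P fun n G hn => ?_
    obtain ⟨y, t, hy, ht, u, v, p, hp, he, hq⟩ :=
      h _ (subdivisionGraph G) (subdivisionSeq G) (hpos G hn) (isTwinSequence_subdivisionSeq G)
    exact ⟨y, t, hy, ht, u, v, p, hp.1, he, hq⟩
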